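/- Let $\Bbbk$ be a field of characteristic $0$, $R=\Bbbk[x_1,\dots,x_n]$, $s\ge 1$, $l\ge 0$. For $\alpha\in\mathbb Z^n$ let $\sigma_\alpha=\{p:\alpha_p\ne 0\}$ and let $q_\alpha\in\{0,1\}^n$ be the vector with support $\sigma_\alpha$; for $L\subseteq[n]$ let $\underline L\in\{0,1\}^n$ be its indicator vector. For $W\subseteq L\subseteq [n]$ let $\mathrm{sgn}[w,L]=(-1)^{r+1}$ if $w$ is the $r$-th smallest element of $L$, and $\mathrm{sgn}[W,L]=\prod_{w\in W}\mathrm{sgn}[w,L]$. Let $A=(c_{ij}x^{a_{ij}})$ be an $s\times l$ matrix over $R$ ($c_{ij}\in\Bbbk$, $a_{ij}\in\mathbb N^n$) that is multigraded (every minor is a scalar times a monomial) and squarefree, and let $\gamma_1,\dots,\gamma_l,\beta_1,\dots,\beta_s\in\{0,1\}^n$ satisfy $\gamma_j-\beta_i=a_{ij}$ whenever $c_{ij}\neq0$. Let $F_0=\bigoplus_i Rv_i$ with $\deg v_i=\beta_i$ and $F_1=\bigoplus_j Rw_j$ with $\deg w_j=\gamma_j$; let $\phi:F_1\to F_0$,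 $\phi(w_j)=\sum_i c_{ij}x^{a_{ij}}v_i$, and let $M_A=\operatorname{coker}\phi$, a $\mathbb Z^n$-graded module. Fix a monomial order on $R$ and order the monomials of $F_0$ by: $uv_i>u'v_j$ iff $i>j$, or $i=j$ and $u>u'$. Let $I_1,\dots,I_s$ be the ideals with $\mathrm{in}(\operatorname{im}\phi)=I_1v_1\oplus\cdots\oplus I_sv_s$, and $\Delta_i=\{\sigma\subseteq[n]: \prod_{p\in\sigma}x_p\notin I_i\}$. For $i\in[s]$ and $a\in\mathbb N^n$ with $\sigma_a\notin\Delta_i$ there are unique scalars $r_{i,j,a}$ ($j<i$) such that $r_{i,j,a}=0$ unless $a+\beta_i-\beta_j\in\mathbb N^n$ and $\sigma_{a+\beta_i-\beta_j}\in\Delta_j$, and $$\overline{x^{a}v_i}=\sum_{j<i} r_{i,j,a}\,\overline{x^{a+\beta_i-\beta_j}v_j}\quad\text{in } M_A .$$ Let $\alpha\in\mathbb Z^n$ and $\alpha_j=\alpha-\beta_j$. Put $\Delta_{j,\alpha}=\{\sigma\subseteq\sigma_{\alpha_j}:\ \sigma\cup\sigma_{\alpha_j-q_{\alpha_j}}\in\Delta_j\}$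 if $\alpha_j\in\mathbb N^n$ and $\Delta_{j,\alpha}=\{\,\}$ (no faces at all) otherwise. Let $l_j=|\sigma_{\alpha_j}|-|\sigma_{\alpha_1}|$. For $t\in\mathbb Z$ let $C^t(A,\alpha)=\bigoplus_{j=1}^s C^{t+l_j}(\Delta_{j,\alpha})$, where $C^{r}(\Delta_{j,\alpha})$ is the $\Bbbk$-vector space with basis the symbols $\tau^*=(j,\tau)^*$ for $\tau\in\Delta_{j,\alpha}$, $|\tau|=r+1$. For a basis element $(j,\tau)^*$ define $$\delta((j,\tau)^*)=\sum_{\substack{t\notin\tau\\ \tau\cup t\in\Delta_{j,\alpha}}}\mathrm{sgn}[t,\tau\cup t]\,(j,\tau\cup t)^*+\sum_{\substack{w\in\sigma_{\alpha_j}\setminus\tau\\ \tau\cup w\notin\Delta_{j,\alpha}}}\ \sum_{i<j}\mathrm{sgn}[w,\tau\cup w]\;r_{j,i,\underline{\tau\cup w}+\alpha_j-q_{\alpha_j}}\;\frac{\mathrm{sgn}[\tau\cup w,\sigma_{\alpha_j}]}{\mathrm{sgn}[f_{w,i},\sigma_{\alpha_i}]}\,(i,f_{w,i})^*,$$ where $f_{w,i}=\sigma_{\alpha_i}\setminus\bigl(\sigma_{\alpha_j}\setminus(\tau\cup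 w)\bigr)$ (for squarefree $\alpha$, whenever the coefficient $r$ is nonzero, this is the set $(\sigma_{\beta_j}\cup\tau\cup w)\setminus\sigma_{\beta_i}$). Then $\delta$ maps $C^t(A,\alpha)$ to $C^{t+1}(A,\alpha)$ for all $t$, $(C^\bullet(A,\alpha),\delta)$ is a cochain complex, and for every $i\ge 0$ the $\alpha$-graded Betti number $b_{i,\alpha}(M_A)$ is $$b_{i,\alpha}(M_A)=\dim_\Bbbk H^{|\sigma_{\alpha_1}|-i-1}\bigl(C^\bullet(A,\alpha)\bigr).$$ Here $b_{i,\alpha}(M_A)=\dim_\Bbbk\operatorname{Tor}_i(M_A,\Bbbk)_\alpha$, and the formula holds in each of its descriptions: as $\dim_\Bbbk H_i(F_\bullet\otimes \Bbbk)_\alpha$ for any multigraded free resolution $F_\bullet$ of $M_A$ by free modules of finite rank, as $\dim_\Bbbk H_i(M_A\otimes K_\bullet)_\alpha$ for the Koszul complex $K_\bullet$ on $x_1,\dots,x_n$, and as the number of generators of degree $\alpha$ of $F_i$ for any minimal multigraded free resolution $F_\bullet$ of $M_A$ by free modules of finite rank. -/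

import Mathlib

open MvPolynomial

noncomputable section

/-! ### Multidegrees -/

/-- Multidegrees `α ∈ ℤⁿ`. -/
abbrev MDeg (n : ℕ) : Type := Fin n → ℤ

/-- The support `σ_α = {p : α_p ≠ 0}`. -/
def mSupp {n : ℕ} (α : MDeg n) : Finset (Fin n) := Finset.univ.filter fun p => α p ≠ 0

/-- The `0/1` vector of a set `L ⊆ [n]`. -/
def mInd {n : ℕ} (L : Finset (Fin n)) : MDeg n := fun p => if p ∈ L then 1 else 0

/-- `q_α`, the squarefree vector with the same support as `α`. -/
def mSqf {n : ℕ} (α : MDeg n) : MDeg n := mInd (mSupp α)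

/-- A vector with all entries in `{0, 1}`. -/
def IsSqf {n : ℕ} (α : MDeg n) : Prop := ∀ p, α p = 0 ∨ α p = 1

/-- The monomial `x^α` for `α ∈ ℕⁿ` (and `0` if `α ∈ ℤⁿ` has a negative entry). -/
def mMon (k : Type*) [Field k] {n : ℕ} (α : MDeg n) : MvPolynomial (Fin n) k :=
  open Classical in
  if 0 ≤ α then monomial (Finsupp.equivFunOnFinite.symm fun p => (α p).toNat) 1 else 0

/-- `sgn[w, L] = (-1)^{r+1}` where `w` is the `r`-th smallest element of `L`. -/
def sgnElt (k : Type*) [Field k] {n : ℕ} (w : Fin n) (L : Finset (Fin n)) : k :=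
  (-1) ^ (L.filter fun p => p < w).card

/-- `sgn[W, L] = ∏_{w ∈ W} sgn[w, L]`. -/
def sgnSet (k : Type*) [Field k] {n : ℕ} (W L : Finset (Fin n)) : k :=
  ∏ w ∈ W, sgnElt k w L

/-- The degree-`α` part of the free module with basis `(e_g)`, `deg e_g = deg g`. -/
def freePart (k : Type*) [Field k] {n : ℕ} {ι : Type*} (deg : ι → MDeg n) (α : MDeg n) :
    Submodule k (ι → MvPolynomial (Fin n) k) where
  carrier := {f | ∀ g, ∀ a ∈ (f g).support, (fun p => (a p : ℤ)) + deg g = α}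
  zero_mem' := by intro g a ha; simp at ha
  add_mem' := by
    classical
    intro f f' hf hf' g a ha
    rcases Finset.mem_union.1 (MvPolynomial.support_add ha) with h | h
    · exact hf g a h
    · exact hf' g a h
  smul_mem' := by
    intro c f hf g a ha
    exact hf g a (MvPolynomial.support_smul ha)

/-- The dimension of `Z / (B ∩ Z)`; for `B ⊆ Z` this is the dimension of the homology `Z / B`. -/
def homologyDim {k V : Type*} [Field k] [AddCommGroup V] [Module k V] (Z B : Submodule k V) : ℕ :=
  Module.finrank k (↥Z ⧸ B.submoduleOf Z)

/-! ### Matrices with monomial entries, and their cokernels -/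

/-- An `s × l` matrix `(c_{ij} x^{a_{ij}})` over `k[x_1, …, x_n]`. -/
structure MonMatrix (k : Type*) (n s l : ℕ) where
  /-- the coefficients `c_{ij}` -/
  coeff : Fin s → Fin l → k
  /-- the exponents `a_{ij}` -/
  expo : Fin s → Fin l → (Fin n →₀ ℕ)

namespace MonMatrix

variable {k : Type*} [Field k] {n s l : ℕ}

/-- The matrix `(c_{ij} x^{a_{ij}})` itself. -/
def toMatrix (A : MonMatrix k n s l) : Matrix (Fin s) (Fin l) (MvPolynomial (Fin n) k) :=
  Matrix.of fun i j => monomial (A.expo i j) (A.coeff i j)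

/-- Every minor is a scalar times a monomial. -/
def IsMultigraded (A : MonMatrix k n s l) : Prop :=
  ∀ (p : ℕ) (e : Fin p ↪o Fin s) (g : Fin p ↪o Fin l),
    ∃ (a : Fin n →₀ ℕ) (c : k), (A.toMatrix.submatrix e g).det = monomial a c

/-- `(γ, β)` solves the system `E_A`: `γ_j - β_i = a_{ij}` whenever `c_{ij} ≠ 0`,
and all the vectors `γ_j`, `β_i` are squarefree. -/
structure IsSquarefreeSolution (A : MonMatrix k n s l)
    (γ : Fin l → MDeg n) (β : Fin s → MDeg n) : Prop where
  eq : ∀ i j, A.coeff i j ≠ 0 → γ j - β i = fun p => (A.expo i j p : ℤ)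
  sqf_col : ∀ j, IsSqf (γ j)
  sqf_row : ∀ i, IsSqf (β i)

/-- The image of `φ : R^l → R^s`, `φ(w_j) = ∑_i c_{ij} x^{a_{ij}} v_i`. -/
def im (A : MonMatrix k n s l) :
    Submodule (MvPolynomial (Fin n) k) (Fin s → MvPolynomial (Fin n) k) :=
  LinearMap.range A.toMatrix.mulVecLin

/-- The module `M_A = coker φ`. -/
abbrev Coker (A : MonMatrix k n s l) : Type _ := (Fin s → MvPolynomial (Fin n) k) ⧸ A.im

/-- The degree-`α` part of `M_A`, where `deg v_i = β_i`. -/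
def part (A : MonMatrix k n s l) (β : Fin s → MDeg n) (α : MDeg n) : Submodule k A.Coker :=
  (freePart k β α).map (A.im.mkQ.restrictScalars k)

/-! ### The initial module, the ideals `I_i`, and the complexes `Δ_i` -/

/-- `x^a v_i` is the initial monomial of `f`, for the module order with `u v_i > u' v_j` iff
`i > j`, or `i = j` and `u > u'` in the monomial order `m`. -/
def IsInitial (m : MonomialOrder (Fin n)) (f : Fin s → MvPolynomial (Fin n) k)
    (i : Fin s) (a : Fin n →₀ ℕ) : Prop :=
  f i ≠ 0 ∧ (∀ j, i < j → f j = 0) ∧ m.degree (f i) = a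

/-- The initial module of `im φ`. -/
def ini (A : MonMatrix k n s l) (m : MonomialOrder (Fin n)) :
    Submodule (MvPolynomial (Fin n) k) (Fin s → MvPolynomial (Fin n) k) :=
  Submodule.span _ {g | ∃ f ∈ A.im, ∃ i a, IsInitial m f i a ∧ g = Pi.single i (monomial a 1)}

/-- The ideal `I_i` with `ini (im φ) = I_1 v_1 ⊕ ⋯ ⊕ I_s v_s`. -/
def idl (A : MonMatrix k n s l) (m : MonomialOrder (Fin n)) (i : Fin s) :
    Ideal (MvPolynomial (Fin n) k) :=
  (A.ini m).comap (LinearMap.single _ (fun _ => MvPolynomial (Fin n) k) i)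

/-- `Δ_i = {σ ⊆ [n] : x^σ ∉ I_i}`. -/
def cplx (A : MonMatrix k n s l) (m : MonomialOrder (Fin n)) (i : Fin s) :
    Set (Finset (Fin n)) :=
  {σ | ∏ p ∈ σ, (X p : MvPolynomial (Fin n) k) ∉ A.idl m i}

/-- `ρ = (ρ_j)_j` are the coefficients of the expression of the class of `x^a v_i` as a
combination of the classes of the `x^{a + β_i - β_j} v_j` with `j < i`, where `ρ_j ≠ 0` only if
`a + β_i - β_j ∈ ℕⁿ` has its support in `Δ_j`. -/
def IsReduction (A : MonMatrix k n s l) (β : Fin s → MDeg n) (m : MonomialOrder (Fin n))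
    (i : Fin s) (a : MDeg n) (ρ : Fin s → k) : Prop :=
  (∀ j, ρ j ≠ 0 → j < i ∧ 0 ≤ a + β i - β j ∧ mSupp (a + β i - β j) ∈ A.cplx m j) ∧
  A.im.mkQ (Pi.single i (mMon k a)) =
    ∑ j, ρ j • A.im.mkQ (Pi.single j (mMon k (a + β i - β j)))

/-- The coefficient `r_{i,j,a}`. -/
def red (A : MonMatrix k n s l) (β : Fin s → MDeg n) (m : MonomialOrder (Fin n))
    (i j : Fin s) (a : MDeg n) : k :=
  open Classical in
  if h : ∃ ρ : Fin s → k, A.IsReduction β m i a ρ then h.choose j else 0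

/-! ### The glued cochain complex `C^•(A, α)` -/

/-- `Δ_{j,α} = {σ ⊆ σ_{α_j} : σ ∪ σ_{α_j - q_{α_j}} ∈ Δ_j}` where `α_j = α - β_j`, and
`Δ_{j,α}` is void if `α_j ∉ ℕⁿ`. -/
def cplxAt (A : MonMatrix k n s l) (β : Fin s → MDeg n) (m : MonomialOrder (Fin n))
    (j : Fin s) (α : MDeg n) : Set (Finset (Fin n)) :=
  {σ | 0 ≤ α - β j ∧ σ ⊆ mSupp (α - β j) ∧
    σ ∪ mSupp ((α - β j) - mSqf (α - β j)) ∈ A.cplx m j}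

/-- For `τ ⊆ σ_{α_j}`: the set `σ_{α_i} \ (σ_{α_j} \ τ)`, that is, the subset of `σ_{α_i}` with
the same complement in `σ_{α_i}` as `τ` has in `σ_{α_j}` (when that complement lies in
`σ_{α_i}`). For squarefree `α` it is `(σ_{β_j} ∪ τ) \ σ_{β_i}`, see `transfer_eq`. -/
def transfer (β : Fin s → MDeg n) (α : MDeg n) (τ : Finset (Fin n)) (j i : Fin s) :
    Finset (Fin n) :=
  mSupp (α - β i) \ (mSupp (α - β j) \ τ)

theorem transfer_eq (β : Fin s → MDeg n) (hβ : ∀ i, IsSqf (β i)) (α : MDeg n) (hα : IsSqf α)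
    (τ : Finset (Fin n)) (j i : Fin s) (hj : 0 ≤ α - β j) (hτ : τ ⊆ mSupp (α - β j))
    (hi : mSupp (β i) ⊆ τ ∪ mSupp (β j)) :
    transfer β α τ j i = (mSupp (β j) ∪ τ) \ mSupp (β i) := by
  ext p
  have h1 := hβ i p
  have h2 := hβ j p
  have h3 := hα p
  have h4 := hj p
  have h5 := @hτ p
  have h6 := @hi p
  simp only [transfer, mSupp, Finset.mem_sdiff, Finset.mem_filter, Finset.mem_univ, true_and,
    Finset.mem_union, Pi.sub_apply, Pi.zero_apply] at *
  by_cases hp : p ∈ τ <;> simp only [hp, true_or, false_or, or_false, or_true, forall_const,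
    not_true, not_false_eq_true, and_true, and_false, true_and] at * <;> omega

/-- The ambient space with basis the symbols `(j, τ)^*`, `j ∈ [s]`, `τ ⊆ [n]`. -/
abbrev Amb (k : Type*) [Field k] (n s : ℕ) : Type _ := (Fin s × Finset (Fin n)) →₀ k

/-- The differential `d_j(τ^*) = ∑ sgn[t, τ t] (τ t)^*`, over the `t ∉ τ` with
`τ t ∈ Δ_{j,α}`. -/
def dBasis (A : MonMatrix k n s l) (β : Fin s → MDeg n) (m : MonomialOrder (Fin n))
    (α : MDeg n) (j : Fin s) (τ : Finset (Fin n)) : Amb k n s :=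
  open Classical in
  ∑ t ∈ Finset.univ.filter fun t => t ∉ τ ∧ insert t τ ∈ A.cplxAt β m j α,
    Finsupp.single (j, insert t τ) (sgnElt k t (insert t τ))

/-- The gluing map `χ_j(τ^*) = ∑_w χ_j(τ^*, w)`, over the vertices `w ∈ σ_{α_j} \ τ` with
`τ w ∉ Δ_{j,α}`. -/
def chiBasis (A : MonMatrix k n s l) (β : Fin s → MDeg n) (m : MonomialOrder (Fin n))
    (α : MDeg n) (j : Fin s) (τ : Finset (Fin n)) : Amb k n s :=
  open Classical in
  ∑ w ∈ (mSupp (α - β j) \ τ).filter fun w => insert w τ ∉ A.cplxAt β m j α,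
    ∑ i ∈ Finset.univ.filter fun i => i < j,
      Finsupp.single (i, transfer β α (insert w τ) j i)
        (sgnElt k w (insert w τ) *
          A.red β m j i (mInd (insert w τ) + (α - β j) - mSqf (α - β j)) *
          (sgnSet k (insert w τ) (mSupp (α - β j)) /
            sgnSet k (transfer β α (insert w τ) j i) (mSupp (α - β i))))

/-- `δ(τ^*) = d_j(τ^*) + χ_j(τ^*)`. -/
def delta (A : MonMatrix k n s l) (β : Fin s → MDeg n) (m : MonomialOrder (Fin n))
    (α : MDeg n) : Amb k n s →ₗ[k] Amb k n s :=
  Finsupp.linearCombination k fun b => A.dBasis β m α b.1 b.2 + A.chiBasis β m α b.1 b.2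

/-- `C^t(A, α) = ⊕_j C^{t + l_j}(Δ_{j,α})`, `l_j = |σ_{α_j}| - |σ_{α_1}|`, with basis the
`(j, τ)^*` such that `τ ∈ Δ_{j,α}` and `|τ| = t + l_j + 1`. The first row has index `0`. -/
def cochains [NeZero s] (A : MonMatrix k n s l) (β : Fin s → MDeg n)
    (m : MonomialOrder (Fin n)) (α : MDeg n) (t : ℤ) : Submodule k (Amb k n s) :=
  Finsupp.supported k k {b | b.2 ∈ A.cplxAt β m b.1 α ∧
    (b.2.card : ℤ) = t + ((mSupp (α - β b.1)).card - (mSupp (α - β 0)).card) + 1}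

/-- `dim_k H^t(C^•(A, α))`. -/
def cohomologyDim [NeZero s] (A : MonMatrix k n s l) (β : Fin s → MDeg n)
    (m : MonomialOrder (Fin n)) (α : MDeg n) (t : ℤ) : ℕ :=
  homologyDim (A.cochains β m α t ⊓ LinearMap.ker (A.delta β m α))
    ((A.cochains β m α (t - 1)).map (A.delta β m α))

/-! ### Graded Betti numbers -/

/-- A multigraded free resolution of `M_A` (each `F_i` free of finite rank on homogeneous
generators). -/
structure FreeResolution (A : MonMatrix k n s l) (β : Fin s → MDeg n) where
  /-- the rank of `F_i` -/
  rank : ℕ → ℕ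
  /-- the degrees of the generators of `F_i` -/
  deg : ∀ i, Fin (rank i) → MDeg n
  /-- the differential `F_{i+1} → F_i` -/
  d : ∀ i, (Fin (rank (i + 1)) → MvPolynomial (Fin n) k) →ₗ[MvPolynomial (Fin n) k]
    (Fin (rank i) → MvPolynomial (Fin n) k)
  /-- the augmentation `F_0 → M_A` -/
  aug : (Fin (rank 0) → MvPolynomial (Fin n) k) →ₗ[MvPolynomial (Fin n) k] A.Coker
  d_homogeneous : ∀ i g, d i (Pi.single g 1) ∈ freePart k (deg i) (deg (i + 1) g)
  aug_homogeneous : ∀ g, aug (Pi.single g 1) ∈ A.part β (deg 0 g)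
  aug_surjective : Function.Surjective aug
  exact_zero : LinearMap.range (d 0) = LinearMap.ker aug
  exact_succ : ∀ i, LinearMap.range (d (i + 1)) = LinearMap.ker (d i)

namespace FreeResolution

variable {A : MonMatrix k n s l} {β : Fin s → MDeg n}

/-- `d(F_{i+1}) ⊆ 𝔪 F_i` for all `i`, where `𝔪 = (x_1, …, x_n)`. -/
def IsMinimal (F : FreeResolution A β) : Prop :=
  ∀ i f g, constantCoeff (F.d i f g) = 0

/-- The number of generators of `F_i` of degree `α`, i.e. `dim_k (F_i ⊗ k)_α`. -/
def genCount (F : FreeResolution A β) (i : ℕ) (α : MDeg n) : ℕ :=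
  Fintype.card {g : Fin (F.rank i) // F.deg i g = α}

/-- `(F_i ⊗ k)_α`, inside `F_i ⊗ k = k^{rank F_i}`. -/
def fibre (F : FreeResolution A β) (i : ℕ) (α : MDeg n) : Submodule k (Fin (F.rank i) → k) where
  carrier := {c | ∀ g, c g ≠ 0 → F.deg i g = α}
  zero_mem' := by intro g hg; simp at hg
  add_mem' := by
    intro c c' hc hc' g hg
    by_cases h : c g = 0
    · exact hc' g (by simpa [h] using hg)
    · exact hc g h
  smul_mem' := by
    intro a c hc g hg
    exact hc g (by intro h; simp [h] at hg)

/-- The differential `F_{i+1} ⊗ k → F_i ⊗ k`. -/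
def dBar (F : FreeResolution A β) (i : ℕ) :
    (Fin (F.rank (i + 1)) → k) →ₗ[k] (Fin (F.rank i) → k) :=
  Matrix.mulVecLin (Matrix.of fun g h => constantCoeff (F.d i (Pi.single h 1) g))

/-- The degree-`α` cycles of `F_• ⊗ k`. -/
def cycles (F : FreeResolution A β) (α : MDeg n) : ∀ i, Submodule k (Fin (F.rank i) → k)
  | 0 => F.fibre 0 α
  | i + 1 => F.fibre (i + 1) α ⊓ LinearMap.ker (F.dBar i)

/-- `dim_k Tor_i(M_A, k)_α`, computed as `dim_k H_i(F_• ⊗ k)_α`. -/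
def torDim (F : FreeResolution A β) (i : ℕ) (α : MDeg n) : ℕ :=
  homologyDim (F.cycles α i) ((F.fibre (i + 1) α).map (F.dBar i))

end FreeResolution

/-- The Koszul differential on `M_A ⊗ K_•`: with `f = ∑_L f_L ⊗ e_L` it is induced by
`e_L ↦ ∑_{t ∈ L} sgn[t, L] x_t e_{L \ t}`. -/
def koszul (A : MonMatrix k n s l) :
    (Finset (Fin n) → A.Coker) →ₗ[k] (Finset (Fin n) → A.Coker) where
  toFun f L := ∑ t ∈ Finset.univ.filter fun t => t ∉ L,
    (C (sgnElt k t (insert t L)) * X t : MvPolynomial (Fin n) k) • f (insert t L)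
  map_add' f g := by
    funext L
    simp only [Pi.add_apply, smul_add, Finset.sum_add_distrib]
  map_smul' c f := by
    funext L
    simp only [Pi.smul_apply, Finset.smul_sum, RingHom.id_apply]
    exact Finset.sum_congr rfl fun t _ => smul_comm _ _ _

/-- `(M_A ⊗ K_i)_α`, the sums `∑ f_L ⊗ e_L` over `|L| = i` with `f_L ∈ (M_A)_{α - L}`. -/
def koszulPart (A : MonMatrix k n s l) (β : Fin s → MDeg n) (α : MDeg n) (i : ℕ) :
    Submodule k (Finset (Fin n) → A.Coker) :=
  Submodule.pi Set.univ fun L => if L.card = i then A.part β (α - mInd L) else ⊥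

/-- `dim_k H_i(M_A ⊗ K_•)_α`. -/
def koszulDim (A : MonMatrix k n s l) (β : Fin s → MDeg n) (α : MDeg n) (i : ℕ) : ℕ :=
  homologyDim (A.koszulPart β α i ⊓ LinearMap.ker A.koszul)
    ((A.koszulPart β α (i + 1)).map A.koszul)

end MonMatrix

end

/-!
The graded Betti numbers of `M_A` are read off from the Koszul complex `(M_A ⊗ K_•)_α`, written in
the basis of standard monomials.

*Standard monomials.* All maps are homogeneous, and a degree contains at most one monomial of each
summand `R v_j`, so leading terms of homogeneous elements of `im φ` see only the order of the `v_j`.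
Because the degrees `γ_j`, `β_i` of all generators are squarefree, division by `x^{a - q_a}` is
possible within `im φ` (`exists_mMon_smul_eq`); hence `x^a v_i` is standard if and only if the
support of `a` lies in `Δ_i` (`MonMatrix.exists_relation`, `MonMatrix.notMem_cplx`). Standard
monomials are independent modulo `im φ` and every element has a normal form, which gives the
coefficients `r_{i,j,a}`.

*The glued complex.* A basis of `(M_A ⊗ K_i)_α` consists of the `x^{α_j - L} v_j ⊗ e_L` with
`|L| = i` and `x^{α_j - L} v_j` standard. Such a pair `(j, L)` is the same as a face
`τ = σ_{α_j} \ L` of `Δ_{j,α}`. The Koszul differential removes an element `w` from `L`, that is, it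
adds `w` to `τ`; the result is again a basis element if `τ ∪ w ∈ Δ_{j,α}`, and otherwise it is
rewritten with the coefficients `r`. Rescaling by `sgn[τ, σ_{α_j}]` turns this into exactly the
differential `δ`, because `sgn[w, L] sgn[w, τ ∪ w] = sgn[w, σ_{α_j}]`. So `MonMatrix.theta` is an
isomorphism from `C^•(A, α)`, reindexed, onto the Koszul complex (`MonMatrix.koszul_theta`,
`MonMatrix.theta_injective`, `MonMatrix.map_theta_cochains`), and `δ² = 0` is inherited from it.

*Free resolutions.* For a free resolution `F_•`, the double complex `(F_• ⊗ K_•)_α` has exact rows,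
by taking homogeneous components of lifts, and exact columns, by an explicit contracting homotopy
(`sum_homotopy_eq`). Zigzags in it give a linear relation between the cycles of `(M_A ⊗ K_•)_α` and
those of `(F_• ⊗ k)_α` that identifies the homologies
(`AugmentedDoubleComplex.homologyDim_edges`). If `F_•` is minimal, the differentials of `F_• ⊗ k`
vanish, and its homology in degree `α` counts generators.
-/

noncomputable section

/-! ### Multigraded pieces of free modules -/

section Grading

variable {k : Type*} [Field k] {n : ℕ} {ι κ : Type*}

/-- The exponent in `ℕⁿ` of `a ∈ ℤⁿ`, with negative entries truncated to `0`. -/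
def toExp (a : MDeg n) : Fin n →₀ ℕ := Finsupp.equivFunOnFinite.symm fun p => (a p).toNat

theorem toExp_natCast (a : Fin n →₀ ℕ) : toExp (fun p => (a p : ℤ)) = a := by
  ext p; simp [toExp]

theorem natCast_toExp {a : MDeg n} (h : 0 ≤ a) : (fun p => (toExp a p : ℤ)) = a := by
  funext p; simpa [toExp] using h p

theorem mMon_of_nonneg {a : MDeg n} (h : 0 ≤ a) : mMon k a = monomial (toExp a) 1 := if_pos h

theorem mMon_of_not_nonneg {a : MDeg n} (h : ¬ 0 ≤ a) : mMon k a = 0 := if_neg h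

theorem mMon_natCast (a : Fin n →₀ ℕ) : mMon k (fun p => (a p : ℤ)) = monomial a 1 := by
  rw [mMon_of_nonneg (fun p => by simp), toExp_natCast]

theorem mMon_ne_zero {a : MDeg n} (h : 0 ≤ a) : mMon k a ≠ 0 := by
  rw [mMon_of_nonneg h]; simp

theorem mMon_mul {a b : MDeg n} (ha : 0 ≤ a) (hb : 0 ≤ b) :
    mMon k a * mMon k b = mMon k (a + b) := by
  rw [mMon_of_nonneg ha, mMon_of_nonneg hb, mMon_of_nonneg (add_nonneg ha hb), monomial_mul,
    one_mul]
  refine congrArg (fun e => monomial e (1 : k)) (Finsupp.ext fun p => ?_)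
  have h1 := ha p
  have h2 := hb p
  simp [toExp] at *
  omega

theorem mInd_nonneg (L : Finset (Fin n)) : (0 : MDeg n) ≤ mInd L := by
  intro p; simp only [mInd, Pi.zero_apply]; split_ifs <;> simp

theorem mMon_mInd (L : Finset (Fin n)) : mMon k (mInd L) = ∏ p ∈ L, X p := by
  classical
  have : (∏ p ∈ L, X p : MvPolynomial (Fin n) k) = monomial (∑ p ∈ L, Finsupp.single p 1) 1 := by
    rw [monomial_sum_one]; rfl
  rw [this, mMon_of_nonneg (mInd_nonneg L)]
  refine congrArg (fun e => monomial e (1 : k)) (Finsupp.ext fun p => ?_)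
  simp only [toExp, mInd, Finsupp.equivFunOnFinite_symm_apply_apply, Finsupp.finsetSum_apply,
    Finsupp.single_apply, Finset.sum_ite_eq']
  split_ifs <;> simp

/-- A degree contains at most one monomial of each summand. -/
theorem mem_freePart_iff {deg : ι → MDeg n} {α : MDeg n} {f : ι → MvPolynomial (Fin n) k} :
    f ∈ freePart k deg α ↔ ∀ g, ∃ c : k, f g = c • mMon k (α - deg g) := by
  constructor
  · intro hf g
    by_cases h0 : f g = 0
    · exact ⟨0, by simp [h0]⟩
    obtain ⟨a, ha⟩ := (MvPolynomial.support_nonempty).2 h0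
    have key : ∀ b ∈ (f g).support, b = a := by
      intro b hb
      have h1 := hf g a ha
      have h2 := hf g b hb
      ext p
      have := congrFun (h1.trans h2.symm) p
      simp at this
      omega
    refine ⟨coeff a (f g), ?_⟩
    have h1 : α - deg g = fun p => (a p : ℤ) := by
      rw [← hf g a ha]; simp
    rw [h1, mMon_natCast, smul_monomial, smul_eq_mul, mul_one]
    ext b
    rw [coeff_monomial]
    split_ifs with h
    · rw [h]
    · by_contra hb
      exact h (key b (mem_support_iff.2 hb)).symm
  · intro h g a ha
    obtain ⟨c, hc⟩ := h g
    by_cases h0 : 0 ≤ α - deg g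
    · rw [hc, mMon_of_nonneg h0, mem_support_iff, coeff_smul, coeff_monomial] at ha
      by_cases h1 : toExp (α - deg g) = a
      · rw [← h1, natCast_toExp h0]; simp
      · simp [h1] at ha
    · rw [hc, mMon_of_not_nonneg h0] at ha; simp at ha

theorem single_mMon_mem_freePart [DecidableEq ι] (deg : ι → MDeg n) (α : MDeg n) (g : ι) :
    Pi.single g (mMon k (α - deg g)) ∈ freePart k deg α := by
  rw [mem_freePart_iff]
  intro h
  by_cases hg : h = g
  · subst hg; exact ⟨1, by simp⟩
  · exact ⟨0, by simp [hg]⟩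

theorem mMon_smul_mem_freePart {deg : ι → MDeg n} {α b : MDeg n}
    {f : ι → MvPolynomial (Fin n) k} (hf : f ∈ freePart k deg α) :
    mMon k b • f ∈ freePart k deg (b + α) := by
  by_cases hb : 0 ≤ b
  · rw [mem_freePart_iff] at hf ⊢
    intro g
    obtain ⟨c, hc⟩ := hf g
    by_cases h0 : 0 ≤ α - deg g
    · exact ⟨c, by rw [Pi.smul_apply, hc, smul_eq_mul, mul_smul_comm, mMon_mul hb h0,
        add_sub_assoc]⟩
    · exact ⟨0, by rw [Pi.smul_apply, hc, mMon_of_not_nonneg h0]; simp⟩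
  · rw [mMon_of_not_nonneg hb, zero_smul]; exact Submodule.zero_mem _

/-- The projection of a graded free module onto its part of degree `α`. -/
def hcomp (deg : ι → MDeg n) (α : MDeg n) :
    (ι → MvPolynomial (Fin n) k) →ₗ[k] (ι → MvPolynomial (Fin n) k) :=
  LinearMap.pi fun g => (LinearMap.toSpanSingleton k _ (mMon k (α - deg g))) ∘ₗ
    (lcoeff k (toExp (α - deg g))) ∘ₗ LinearMap.proj g

theorem hcomp_apply (deg : ι → MDeg n) (α : MDeg n) (f : ι → MvPolynomial (Fin n) k) (g : ι) :
    hcomp deg α f g = coeff (toExp (α - deg g)) (f g) • mMon k (α - deg g) := rfl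

theorem hcomp_mem (deg : ι → MDeg n) (α : MDeg n) (f : ι → MvPolynomial (Fin n) k) :
    hcomp deg α f ∈ freePart k deg α :=
  mem_freePart_iff.2 fun _ => ⟨_, hcomp_apply deg α f _⟩

theorem hcomp_of_mem {deg : ι → MDeg n} {α : MDeg n} {f : ι → MvPolynomial (Fin n) k}
    (hf : f ∈ freePart k deg α) : hcomp deg α f = f := by
  funext g
  obtain ⟨c, hc⟩ := mem_freePart_iff.1 hf g
  rw [hcomp_apply, hc]
  by_cases h0 : 0 ≤ α - deg g
  · rw [mMon_of_nonneg h0, coeff_smul, coeff_monomial, if_pos rfl, smul_eq_mul, mul_one]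
  · rw [mMon_of_not_nonneg h0]; simp

theorem hcomp_of_mem_of_ne {deg : ι → MDeg n} {α α' : MDeg n} {f : ι → MvPolynomial (Fin n) k}
    (hf : f ∈ freePart k deg α') (hne : α' ≠ α) : hcomp deg α f = 0 := by
  funext g
  rw [hcomp_apply]
  by_cases h0 : 0 ≤ α - deg g
  · have : coeff (toExp (α - deg g)) (f g) = 0 := by
      by_contra h
      apply hne
      rw [← hf g _ (mem_support_iff.2 h), natCast_toExp h0]; simp
    rw [this]; simp
  · rw [mMon_of_not_nonneg h0]; simp

/-- Two linear maps that agree on all homogeneous elements are equal. -/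
theorem linearMap_ext_freePart [Finite ι] {M : Type*} [AddCommGroup M] [Module k M]
    (deg : ι → MDeg n) {T T' : (ι → MvPolynomial (Fin n) k) →ₗ[k] M}
    (h : ∀ α, ∀ f ∈ freePart k deg α, T f = T' f) : T = T' := by
  classical
  refine LinearMap.pi_ext' fun g => ?_
  refine MvPolynomial.linearMap_ext fun a => LinearMap.ext fun c => ?_
  refine h ((fun p => (a p : ℤ)) + deg g) _ (mem_freePart_iff.2 fun g' => ?_)
  by_cases hg : g' = g
  · subst hg
    refine ⟨c, ?_⟩
    rw [add_sub_cancel_right, mMon_natCast, smul_monomial]; simp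
  · exact ⟨0, by simp [hg]⟩

theorem map_hcomp [Finite ι] {deg : ι → MDeg n} {deg' : κ → MDeg n}
    (T : (ι → MvPolynomial (Fin n) k) →ₗ[k] (κ → MvPolynomial (Fin n) k))
    (hT : ∀ α, ∀ f ∈ freePart k deg α, T f ∈ freePart k deg' α) (α : MDeg n)
    (f : ι → MvPolynomial (Fin n) k) : T (hcomp deg α f) = hcomp deg' α (T f) := by
  have : T ∘ₗ hcomp deg α = hcomp deg' α ∘ₗ T := by
    refine linearMap_ext_freePart deg fun α' f hf => ?_
    simp only [LinearMap.comp_apply]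
    by_cases h : α' = α
    · subst h; rw [hcomp_of_mem hf, hcomp_of_mem (hT _ _ hf)]
    · rw [hcomp_of_mem_of_ne hf h, hcomp_of_mem_of_ne (hT _ _ hf) h, map_zero]
  exact LinearMap.congr_fun this f

/-- An `R`-linear map that sends generators to homogeneous elements of the same degree is
homogeneous. -/
theorem map_mem_freePart [Fintype ι] [DecidableEq ι] {deg : ι → MDeg n} {deg' : κ → MDeg n}
    (T : (ι → MvPolynomial (Fin n) k) →ₗ[MvPolynomial (Fin n) k] (κ → MvPolynomial (Fin n) k))
    (hT : ∀ g, T (Pi.single g 1) ∈ freePart k deg' (deg g)) (α : MDeg n)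
    {f : ι → MvPolynomial (Fin n) k} (hf : f ∈ freePart k deg α) :
    T f ∈ freePart k deg' α := by
  have hf' : T f = ∑ g, f g • T (Pi.single g 1) := by
    conv_lhs => rw [pi_eq_sum_univ' f]
    rw [map_sum]
    refine Finset.sum_congr rfl fun g _ => ?_
    rw [map_smul]
  rw [hf']
  refine Submodule.sum_mem _ fun g _ => ?_
  obtain ⟨c, hc⟩ := mem_freePart_iff.1 hf g
  rw [hc, smul_assoc]
  refine Submodule.smul_mem _ _ ?_
  simpa using mMon_smul_mem_freePart (b := α - deg g) (hT g)

/-- Division by a monomial: if `α' ≤ α` and no generator is lost on passing from `α` to `α'`, then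
multiplication by `x^{α - α'}` maps the part of degree `α'` onto the part of degree `α`. -/
theorem exists_mMon_smul_eq {deg : ι → MDeg n} {α α' : MDeg n} (hα : α' ≤ α)
    (h : ∀ g, 0 ≤ α - deg g → 0 ≤ α' - deg g)
    {f : ι → MvPolynomial (Fin n) k} (hf : f ∈ freePart k deg α) :
    ∃ f' ∈ freePart k deg α', f = mMon k (α - α') • f' := by
  choose c hc using mem_freePart_iff.1 hf
  refine ⟨fun g => c g • mMon k (α' - deg g), mem_freePart_iff.2 fun g => ⟨c g, rfl⟩, ?_⟩
  funext g
  rw [hc, Pi.smul_apply, smul_eq_mul, mul_smul_comm]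
  by_cases h0 : 0 ≤ α - deg g
  · rw [mMon_mul (sub_nonneg.2 hα) (h g h0), sub_add_sub_cancel]
  · rw [mMon_of_not_nonneg h0, mMon_of_not_nonneg (a := α' - deg g), mul_zero]
    intro h'
    exact h0 (h'.trans (sub_le_sub_right hα _))

end Grading

/-! ### Subtracting indicator vectors -/

section Degrees

variable {n : ℕ}

theorem sub_mInd_erase {α : MDeg n} {L : Finset (Fin n)} {w : Fin n} (hw : w ∈ L) :
    α - mInd (L.erase w) = mInd {w} + (α - mInd L) := by
  funext p
  simp only [mInd, Pi.sub_apply, Pi.add_apply, Finset.mem_erase, Finset.mem_singleton]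
  by_cases h : p = w
  · subst h; simp [hw]
  · simp [h]

theorem subset_mSupp_of_nonneg {α b : MDeg n} {L : Finset (Fin n)}
    (h : 0 ≤ α - mInd L - b) : 0 ≤ α - b ∧ L ⊆ mSupp (α - b) := by
  constructor
  · intro p
    have := h p
    simp only [mInd, Pi.sub_apply, Pi.zero_apply] at this ⊢
    split_ifs at this <;> omega
  · intro p hp
    have := h p
    simp only [mInd, Pi.sub_apply, Pi.zero_apply, hp, if_true] at this
    simp only [mSupp, Finset.mem_filter, Finset.mem_univ, true_and, Pi.sub_apply]
    omega

theorem sub_mInd_nonneg {α b : MDeg n} (h : 0 ≤ α - b) {L : Finset (Fin n)}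
    (hL : L ⊆ mSupp (α - b)) : 0 ≤ α - mInd L - b := by
  intro p
  have h1 := h p
  have h2 := @hL p
  simp only [mInd, mSupp, Pi.sub_apply, Pi.zero_apply, Finset.mem_filter, Finset.mem_univ,
    true_and] at h1 h2 ⊢
  split_ifs with h3
  · have := h2 h3; omega
  · omega

/-- The exponent `α_j - L` with `L = σ_{α_j} \ τ` has support `τ ∪ σ_{α_j - q_{α_j}}`. -/
theorem mSupp_sub_mInd_sdiff {α b : MDeg n} (h : 0 ≤ α - b) {τ : Finset (Fin n)}
    (hτ : τ ⊆ mSupp (α - b)) :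
    mSupp (α - mInd (mSupp (α - b) \ τ) - b) = τ ∪ mSupp ((α - b) - mSqf (α - b)) := by
  ext p
  have h1 := h p
  have h2 := @hτ p
  simp only [mInd, mSqf, mSupp, Pi.sub_apply, Pi.zero_apply, Finset.mem_filter, Finset.mem_univ,
    true_and, Finset.mem_sdiff, Finset.mem_union] at h1 h2 ⊢
  by_cases h3 : p ∈ τ
  · have := h2 h3; simp only [h3]; simp; omega
  · simp only [h3]
    by_cases h4 : α p - b p = 0
    · simp [h4]
    · simp [h4]; omega

/-- The exponent `τ + α_j - q_{α_j}` at which the coefficients `r` are taken is `α_j - L` with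
`L = σ_{α_j} \ τ`. -/
theorem mInd_add_sub_mSqf {α b : MDeg n} {τ : Finset (Fin n)} (hτ : τ ⊆ mSupp (α - b)) :
    mInd τ + (α - b) - mSqf (α - b) = α - mInd (mSupp (α - b) \ τ) - b := by
  funext p
  have h2 := @hτ p
  simp only [mInd, mSqf, Pi.sub_apply, Pi.add_apply, Finset.mem_sdiff]
  by_cases h3 : p ∈ τ
  · simp [h3, h2 h3]
  · by_cases h4 : p ∈ mSupp (α - b) <;> simp [h3, h4] ; ring

end Degrees

/-! ### Standard monomials of `M_A` -/

namespace MonMatrix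

variable {k : Type*} [Field k] {n s l : ℕ} {A : MonMatrix k n s l} {γ : Fin l → MDeg n}
  {β : Fin s → MDeg n} {m : MonomialOrder (Fin n)}

/-- The monomial `x^{α - β_j} v_j` of degree `α` exists and is standard modulo `im φ`. By
squarefreeness, standardness depends only on the support of `α - β_j`. -/
def IsStd (A : MonMatrix k n s l) (β : Fin s → MDeg n) (m : MonomialOrder (Fin n)) (α : MDeg n)
    (j : Fin s) : Prop :=
  0 ≤ α - β j ∧ mSupp (α - β j) ∈ A.cplx m j

/-- A monomial in the initial module is divisible by one of its generators. -/
theorem exists_isInitial_of_mem_ini {i : Fin s} {a : Fin n →₀ ℕ}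
    (h : Pi.single i (monomial a (1 : k)) ∈ A.ini m) :
    ∃ b ≤ a, ∃ f ∈ A.im, IsInitial m f i b := by
  classical
  -- the module of all `g` whose monomials are divisible by leading monomials of `im φ`
  let N : Submodule (MvPolynomial (Fin n) k) (Fin s → MvPolynomial (Fin n) k) :=
    { carrier := {g | ∀ i, ∀ a ∈ (g i).support, ∃ b ≤ a, ∃ f ∈ A.im, IsInitial m f i b}
      zero_mem' := by intro i a ha; simp at ha
      add_mem' := by
        intro f f' hf hf' i a ha
        rcases Finset.mem_union.1 (MvPolynomial.support_add ha) with h | h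
        · exact hf i a h
        · exact hf' i a h
      smul_mem' := by
        intro r f hf i a ha
        obtain ⟨x, -, y, hy, rfl⟩ := Finset.mem_add.1 (MvPolynomial.support_mul _ _ ha)
        obtain ⟨b, hb, hb'⟩ := hf i y hy
        exact ⟨b, hb.trans le_add_self, hb'⟩ }
  have hN : A.ini m ≤ N := by
    refine Submodule.span_le.2 ?_
    rintro _ ⟨f, hf, i, a, hfa, rfl⟩ i' a' ha'
    by_cases hi : i' = i
    · subst hi
      rw [Pi.single_eq_same] at ha'
      have := Finset.mem_singleton.1 (support_monomial_subset ha')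
      exact ⟨a, this.ge, f, hf, hfa⟩
    · simp [hi] at ha'
  exact hN h i a (by simp [MvPolynomial.coeff_monomial])

theorem mulVecLin_mem_freePart (hT : A.IsSquarefreeSolution γ β) {α : MDeg n}
    {u : Fin l → MvPolynomial (Fin n) k} (hu : u ∈ freePart k γ α) :
    A.toMatrix.mulVecLin u ∈ freePart k β α := by
  refine map_mem_freePart _ (fun j => ?_) α hu
  refine mem_freePart_iff.2 fun i => ?_
  rw [Matrix.mulVecLin_apply, Matrix.mulVec_single_one]
  refine ⟨A.coeff i j, ?_⟩
  by_cases h : A.coeff i j = 0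
  · simp [toMatrix, h]
  · rw [hT.eq i j h, mMon_natCast, smul_monomial]; simp [toMatrix]

/-- The submodule `im φ` is homogeneous. -/
theorem hcomp_mem_im (hT : A.IsSquarefreeSolution γ β) (α : MDeg n)
    {f : Fin s → MvPolynomial (Fin n) k} (hf : f ∈ A.im) : hcomp β α f ∈ A.im := by
  obtain ⟨u, rfl⟩ := hf
  exact ⟨hcomp γ α u, map_hcomp (A.toMatrix.mulVecLin.restrictScalars k)
    (fun _ _ hu => mulVecLin_mem_freePart hT hu) α u⟩

theorem im_smul_mem (c : k) {f : Fin s → MvPolynomial (Fin n) k} (hf : f ∈ A.im) :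
    c • f ∈ A.im := by
  rw [← algebraMap_smul (MvPolynomial (Fin n) k) c f]
  exact A.im.smul_mem _ hf

/-- A nonstandard monomial `x^a v_i` is the leading term of a homogeneous element of `im φ`. -/
theorem exists_relation (hT : A.IsSquarefreeSolution γ β) {i : Fin s} {a : MDeg n} (ha : 0 ≤ a)
    (hn : mSupp a ∉ A.cplx m i) :
    ∃ f ∈ A.im, f ∈ freePart k β (a + β i) ∧ f i = mMon k a ∧ ∀ j, i < j → f j = 0 := by
  have h1 : Pi.single i (monomial (toExp (mInd (mSupp a))) (1 : k)) ∈ A.ini m := by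
    have h := not_not.1 hn
    rwa [← mMon_mInd, mMon_of_nonneg (mInd_nonneg _)] at h
  obtain ⟨b, hb, f, hf, hf1, hf2, hf3⟩ := exists_isInitial_of_mem_ini h1
  have hc : MvPolynomial.coeff b (f i) ≠ 0 := by
    rw [← hf3]; exact m.coeff_degree_ne_zero_iff.2 hf1
  have hba : (fun p => (b p : ℤ)) ≤ a := by
    intro p
    have h2 := hb p
    have h3 := ha p
    simp only [toExp, mInd, mSupp, Finsupp.equivFunOnFinite_symm_apply_apply, Finset.mem_filter,
      Finset.mem_univ, true_and, Pi.zero_apply] at h2 h3 ⊢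
    split_ifs at h2 <;> simp at h2 <;> omega
  -- the homogeneous component of `f` containing its leading term, rescaled and shifted to `x^a`
  set f1 := hcomp β ((fun p => (b p : ℤ)) + β i) f with hf1'
  refine ⟨(MvPolynomial.coeff b (f i))⁻¹ • mMon k (a - fun p => (b p : ℤ)) • f1,
    im_smul_mem _ (A.im.smul_mem _ (hcomp_mem_im hT _ hf)), ?_, ?_, ?_⟩
  · refine Submodule.smul_mem _ _ ?_
    have := mMon_smul_mem_freePart (b := a - fun p => (b p : ℤ))
      (hcomp_mem β ((fun p => (b p : ℤ)) + β i) f)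
    rwa [← add_assoc, sub_add_cancel] at this
  · rw [Pi.smul_apply, Pi.smul_apply, hf1', hcomp_apply, add_sub_cancel_right, toExp_natCast,
      smul_eq_mul, mul_smul_comm, smul_smul, inv_mul_cancel₀ hc, one_smul,
      mMon_mul (sub_nonneg.2 hba) (fun p => by simp), sub_add_cancel]
  · intro j hj
    rw [Pi.smul_apply, Pi.smul_apply, hf1', hcomp_apply, hf2 j hj]; simp

/-- The leading monomial of a homogeneous element of `im φ` is nonstandard, already for its
support: multiplication by `x^{a - q_a}` is bijective on the relevant graded parts because all
degrees of generators are squarefree. -/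
theorem notMem_cplx (hT : A.IsSquarefreeSolution γ β) {i : Fin s} {a : MDeg n} (ha : 0 ≤ a)
    {f : Fin s → MvPolynomial (Fin n) k} (hf : f ∈ A.im) (hfa : f ∈ freePart k β (a + β i))
    (hfi : f i ≠ 0) (hfj : ∀ j, i < j → f j = 0) : mSupp a ∉ A.cplx m i := by
  obtain ⟨u, rfl⟩ := hf
  have hu : A.toMatrix.mulVecLin (hcomp γ (a + β i) u) = A.toMatrix.mulVecLin u :=
    (map_hcomp (A.toMatrix.mulVecLin.restrictScalars k)
      (fun _ _ hu => mulVecLin_mem_freePart hT hu) (a + β i) u).trans (hcomp_of_mem hfa)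
  have hle : mSqf a ≤ a := by
    intro p
    have := ha p
    simp only [mSqf, mInd, mSupp, Finset.mem_filter, Finset.mem_univ, true_and,
      Pi.zero_apply] at this ⊢
    split_ifs <;> omega
  obtain ⟨u', hu', huu⟩ := exists_mMon_smul_eq (α' := mSqf a + β i)
    (add_le_add_left hle (β i)) (fun g hg p => by
      have h1 := ha p
      have h2 := hT.sqf_col g p
      have h3 := hT.sqf_row i p
      have h4 := hg p
      simp only [mSqf, mInd, mSupp, Finset.mem_filter, Finset.mem_univ, true_and, Pi.zero_apply,
        Pi.sub_apply, Pi.add_apply] at h1 h4 ⊢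
      split_ifs <;> omega) (hcomp_mem γ (a + β i) u)
  rw [← hu, huu, map_smul] at hfi hfj
  set f' := A.toMatrix.mulVecLin u'
  have hne : mMon k (a + β i - (mSqf a + β i)) ≠ 0 :=
    mMon_ne_zero (sub_nonneg.2 (add_le_add_left hle _))
  have hf'i : f' i ≠ 0 := by
    intro h; apply hfi; rw [Pi.smul_apply, h, smul_zero]
  have hf'j : ∀ j, i < j → f' j = 0 := by
    intro j hj
    have := hfj j hj
    rw [Pi.smul_apply, smul_eq_mul] at this
    exact (mul_eq_zero.1 this).resolve_left hne
  obtain ⟨c, hc⟩ := mem_freePart_iff.1 (mulVecLin_mem_freePart hT hu') i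
  have hf'c : f' i = monomial (toExp (mSqf a)) c := by
    rw [show f' i = _ from hc, add_sub_cancel_right,
      mMon_of_nonneg (show 0 ≤ mSqf a from mInd_nonneg _), smul_monomial]
    simp
  have hdeg : m.degree (f' i) = toExp (mSqf a) := by
    classical
    have : c ≠ 0 := by rintro rfl; apply hf'i; simp [hf'c]
    rw [hf'c, m.degree_monomial, if_neg this]
  refine not_not.2 ?_
  rw [← mMon_mInd, mMon_of_nonneg (mInd_nonneg _)]
  exact Submodule.subset_span ⟨f', ⟨u', rfl⟩, i, _, ⟨hf'i, hf'j, hdeg⟩, rfl⟩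

/-- Standard monomials are linearly independent modulo `im φ`. -/
theorem eq_zero_of_isStd (hT : A.IsSquarefreeSolution γ β) {α : MDeg n}
    {f : Fin s → MvPolynomial (Fin n) k} (hf : f ∈ A.im) (hfα : f ∈ freePart k β α)
    (hstd : ∀ j, f j ≠ 0 → A.IsStd β m α j) : f = 0 := by
  classical
  by_contra hne
  obtain ⟨j0, hj0⟩ := Function.ne_iff.1 hne
  obtain ⟨i, hi, hmax⟩ := Finset.exists_max_image (Finset.univ.filter fun j => f j ≠ 0) id
    ⟨j0, by simpa using hj0⟩
  have hi' : f i ≠ 0 := by simpa using hi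
  refine notMem_cplx hT (hstd i hi').1 hf (by rwa [sub_add_cancel]) hi' (fun j hj => ?_)
    (hstd i hi').2
  by_contra h
  exact absurd (hmax j (by simpa using h)) (not_le.2 hj)

/-- Normal forms with respect to the standard monomials. The bound `N` on the components that occur
is kept because the expression of `x^a v_i` may only involve the `v_j` with `j < i`. -/
theorem exists_normalForm (hT : A.IsSquarefreeSolution γ β) (m : MonomialOrder (Fin n))
    {α : MDeg n} (N : ℕ) :
    ∀ f ∈ freePart k β α, (∀ j : Fin s, N ≤ j → f j = 0) →
      ∃ g ∈ freePart k β α, (∀ j, g j ≠ 0 → A.IsStd β m α j ∧ (j : ℕ) < N) ∧ f - g ∈ A.im := by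
  induction N with
  | zero =>
    intro f hf h
    have : f = 0 := funext fun j => h j (Nat.zero_le _)
    exact ⟨0, Submodule.zero_mem _, by simp, by simp [this]⟩
  | succ N ih =>
    intro f hf h
    -- split off the top component: keep its monomial if standard, otherwise subtract a relation
    by_cases hN : ∃ i : Fin s, (i : ℕ) = N ∧ f i ≠ 0
    swap
    · obtain ⟨g, hg, hg1, hg2⟩ := ih f hf fun j hj => by
        rcases hj.eq_or_lt with hj | hj
        · by_contra h'; exact hN ⟨j, hj.symm, h'⟩
        · exact h j hj
      exact ⟨g, hg, fun j hj => ⟨(hg1 j hj).1, (hg1 j hj).2.trans (Nat.lt_succ_self N)⟩, hg2⟩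
    obtain ⟨i, hiN, hi⟩ := hN
    obtain ⟨c, hc⟩ := mem_freePart_iff.1 hf i
    have h0 : 0 ≤ α - β i := by
      by_contra h0; apply hi; rw [hc, mMon_of_not_nonneg h0, smul_zero]
    by_cases hstd : A.IsStd β m α i
    · have hs : Pi.single i (f i) ∈ freePart k β α := by
        have := Submodule.smul_mem _ c (single_mMon_mem_freePart (k := k) β α i)
        rwa [← Pi.single_smul, ← hc] at this
      obtain ⟨g, hg, hg1, hg2⟩ := ih (f - Pi.single i (f i)) (Submodule.sub_mem _ hf hs)
        fun j hj => by
          by_cases hji : j = i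
          · subst hji; simp
          · rw [Pi.sub_apply, Pi.single_eq_of_ne hji, sub_zero]
            refine h j (lt_of_le_of_ne hj fun h' => hji (Fin.ext ?_))
            rw [← h', hiN]
      refine ⟨g + Pi.single i (f i), Submodule.add_mem _ hg hs, fun j hj => ?_, ?_⟩
      · by_cases hji : j = i
        · subst hji; exact ⟨hstd, by omega⟩
        · rw [Pi.add_apply, Pi.single_eq_of_ne hji, add_zero] at hj
          exact ⟨(hg1 j hj).1, (hg1 j hj).2.trans (Nat.lt_succ_self N)⟩
      · rwa [add_comm, ← sub_sub]
    · obtain ⟨r, hr, hr1, hr2, hr3⟩ := exists_relation hT (m := m) (i := i) h0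
        fun h' => hstd ⟨h0, h'⟩
      rw [sub_add_cancel] at hr1
      obtain ⟨g, hg, hg1, hg2⟩ := ih (f - c • r)
        (Submodule.sub_mem _ hf (Submodule.smul_mem _ _ hr1)) fun j hj => by
          rcases hj.eq_or_lt with hj | hj
          · have : j = i := Fin.ext (by omega)
            subst this
            rw [Pi.sub_apply, Pi.smul_apply, hr2, ← hc, sub_self]
          · rw [Pi.sub_apply, Pi.smul_apply, hr3 j (by rw [Fin.lt_def]; omega), h j hj]; simp
      refine ⟨g, hg, fun j hj => ⟨(hg1 j hj).1, (hg1 j hj).2.trans (Nat.lt_succ_self N)⟩, ?_⟩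
      have := A.im.add_mem hg2 (im_smul_mem c hr)
      convert this using 1
      abel

theorem mkQ_smul (c : k) (f : Fin s → MvPolynomial (Fin n) k) :
    A.im.mkQ (c • f) = c • A.im.mkQ f :=
  (A.im.mkQ.restrictScalars k).map_smul c f

theorem existsUnique_isReduction (hT : A.IsSquarefreeSolution γ β) (m : MonomialOrder (Fin n))
    (i : Fin s) (a : MDeg n) (ha : 0 ≤ a) (hn : mSupp a ∉ A.cplx m i) :
    ∃! ρ : Fin s → k, A.IsReduction β m i a ρ := by
  classical
  refine existsUnique_of_exists_of_unique ?_ ?_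
  · obtain ⟨r, hr, hr1, hr2, hr3⟩ := exists_relation hT ha hn
    have hs : Pi.single i (mMon k a) ∈ freePart k β (a + β i) := by
      have := single_mMon_mem_freePart (k := k) β (a + β i) i
      rwa [add_sub_cancel_right] at this
    obtain ⟨g, hg, hg1, hg2⟩ := exists_normalForm hT m i (Pi.single i (mMon k a) - r)
      (Submodule.sub_mem _ hs hr1) fun j hj => by
        rcases hj.eq_or_lt with hj | hj
        · have : j = i := Fin.ext hj.symm
          subst this
          simp [hr2]
        · rw [Pi.sub_apply, Pi.single_eq_of_ne (fun h => by simp [h] at hj),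
            hr3 j (by rwa [Fin.lt_def]), sub_zero]
    choose c hc using mem_freePart_iff.1 hg
    refine ⟨fun j => if g j = 0 then 0 else c j, fun j hj => ?_, ?_⟩
    · have hj' : g j ≠ 0 := fun h => hj (by simp [h])
      exact ⟨Fin.lt_def.2 (hg1 j hj').2, (hg1 j hj').1.1, (hg1 j hj').1.2⟩
    · have h1 : A.im.mkQ (Pi.single i (mMon k a)) = A.im.mkQ g := by
        rw [← sub_eq_zero, ← map_sub, Submodule.mkQ_apply, Submodule.Quotient.mk_eq_zero]
        have := A.im.add_mem hg2 hr
        convert this using 1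
        abel
      rw [h1]
      simp only [← mkQ_smul, ← map_sum]
      congr 1
      funext j
      rw [Finset.sum_apply, Finset.sum_eq_single j (fun j' _ h => by
        rw [Pi.smul_apply, Pi.single_eq_of_ne h.symm, smul_zero]) (by simp)]
      rw [Pi.smul_apply, Pi.single_eq_same]
      split_ifs with h
      · rw [h, zero_smul]
      · exact hc j
  · rintro ρ ρ' ⟨h1, h2⟩ ⟨h1', h2'⟩
    -- the difference of two reductions is a relation between standard monomials
    set f : Fin s → MvPolynomial (Fin n) k := fun j => (ρ j - ρ' j) • mMon k (a + β i - β j)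
      with hf
    have hfs : f = ∑ j, ρ j • Pi.single j (mMon k (a + β i - β j)) -
        ∑ j, ρ' j • Pi.single j (mMon k (a + β i - β j)) := by
      rw [← Finset.sum_sub_distrib]
      funext j
      rw [Finset.sum_apply, Finset.sum_eq_single j (fun j' _ h => by
        simp [Pi.single_eq_of_ne h.symm]) (by simp)]
      simp [hf, sub_smul]
    have hfim : f ∈ A.im := by
      rw [← Submodule.Quotient.mk_eq_zero, ← Submodule.mkQ_apply, hfs, map_sub, map_sum, map_sum]
      simp only [mkQ_smul]
      rw [← h2, ← h2', sub_self]
    have h0 : f = 0 := by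
      refine eq_zero_of_isStd hT (m := m) hfim (mem_freePart_iff.2 fun j => ⟨_, rfl⟩) fun j hj => ?_
      by_cases h : ρ j = 0
      · by_cases h' : ρ' j = 0
        · simp [hf, h, h'] at hj
        · exact (h1' j h').2
      · exact (h1 j h).2
    funext j
    by_cases hj : 0 ≤ a + β i - β j
    · have := congrFun h0 j
      rw [hf, Pi.zero_apply, smul_eq_zero] at this
      exact sub_eq_zero.1 (this.resolve_right (mMon_ne_zero hj))
    · have e1 : ρ j = 0 := by by_contra h; exact hj (h1 j h).2.1
      have e2 : ρ' j = 0 := by by_contra h; exact hj (h1' j h).2.1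
      rw [e1, e2]

theorem isReduction_red (hT : A.IsSquarefreeSolution γ β) (m : MonomialOrder (Fin n))
    {i : Fin s} {a : MDeg n} (ha : 0 ≤ a) (hn : mSupp a ∉ A.cplx m i) :
    A.IsReduction β m i a fun j => A.red β m i j a := by
  have h := (existsUnique_isReduction hT m i a ha hn).exists
  have : (fun j => A.red β m i j a) = h.choose := by
    funext j; rw [red, dif_pos h]
  rw [this]
  exact h.choose_spec

end MonMatrix

/-! ### Comparing the homology of the two edges of a double complex -/

section HomologyDim

variable {k V V' : Type*} [Field k] [AddCommGroup V] [Module k V] [AddCommGroup V'] [Module k V']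

/-- A linear relation between cycles that is total on both sides and matches boundaries with
boundaries identifies the homologies. -/
theorem homologyDim_eq_of_relation {Z B : Submodule k V} {Z' B' : Submodule k V'}
    (R : Submodule k (V × V')) (hZ : ∀ z ∈ Z, ∃ z' ∈ Z', (z, z') ∈ R)
    (hZ' : ∀ z' ∈ Z', ∃ z ∈ Z, (z, z') ∈ R)
    (hB : ∀ z ∈ Z, ∀ z' ∈ Z', (z, z') ∈ R → (z ∈ B ↔ z' ∈ B')) :
    homologyDim Z B = homologyDim Z' B' := by
  let T : Submodule k (V × V') := R ⊓ Z.prod Z'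
  let f : T →ₗ[k] Z := ((LinearMap.fst k V V').comp T.subtype).codRestrict Z fun t => t.2.2.1
  let g : T →ₗ[k] Z' := ((LinearMap.snd k V V').comp T.subtype).codRestrict Z' fun t => t.2.2.2
  have hf : Function.Surjective ((B.submoduleOf Z).mkQ ∘ₗ f) := by
    rw [LinearMap.coe_comp]
    refine (Submodule.mkQ_surjective _).comp fun z => ?_
    obtain ⟨z', h1, h2⟩ := hZ z z.2
    exact ⟨⟨(z, z'), h2, z.2, h1⟩, rfl⟩
  have hg : Function.Surjective ((B'.submoduleOf Z').mkQ ∘ₗ g) := by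
    rw [LinearMap.coe_comp]
    refine (Submodule.mkQ_surjective _).comp fun z' => ?_
    obtain ⟨z, h1, h2⟩ := hZ' z' z'.2
    exact ⟨⟨(z, z'), h2, h1, z'.2⟩, rfl⟩
  have hker : LinearMap.ker ((B.submoduleOf Z).mkQ ∘ₗ f) =
      LinearMap.ker ((B'.submoduleOf Z').mkQ ∘ₗ g) := by
    rw [LinearMap.ker_comp, LinearMap.ker_comp, Submodule.ker_mkQ, Submodule.ker_mkQ]
    ext ⟨⟨z, z'⟩, h1, h2, h3⟩
    exact hB z h2 z' h3 h1
  exact ((LinearMap.quotKerEquivOfSurjective _ hf).symm ≪≫ₗ Submodule.quotEquivOfEq _ _ hker ≪≫ₗ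
    LinearMap.quotKerEquivOfSurjective _ hg).finrank_eq

end HomologyDim

/-- A first-quadrant double complex `D p q` with commuting differentials `d` (lowering `p`) and `δ`
(lowering `q`), all rows exact with augmentation to a complex `X q` and all columns exact with
augmentation to a complex `Y p`. The spaces are given as subspaces of ambient spaces on which the
maps are defined. -/
structure AugmentedDoubleComplex (k : Type*) [Field k] (V U : ℕ → Type*) (W : Type*)
    [∀ p, AddCommGroup (V p)] [∀ p, Module k (V p)] [∀ p, AddCommGroup (U p)]
    [∀ p, Module k (U p)] [AddCommGroup W] [Module k W] where
  /-- the spaces of the double complex -/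
  D : ∀ p, ℕ → Submodule k (V p)
  /-- the horizontal differential -/
  d : ∀ p, V (p + 1) →ₗ[k] V p
  /-- the vertical differential -/
  δ : ∀ p, V p →ₗ[k] V p
  /-- the complex augmenting the rows -/
  X : ℕ → Submodule k W
  /-- its differential -/
  δX : W →ₗ[k] W
  /-- the augmentation of the rows -/
  ε : V 0 →ₗ[k] W
  /-- the complex augmenting the columns -/
  Y : ∀ p, Submodule k (U p)
  /-- its differential -/
  dY : ∀ p, U (p + 1) →ₗ[k] U p
  /-- the augmentation of the columns -/
  η : ∀ p, V p →ₗ[k] U p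
  d_mem : ∀ {p q z}, z ∈ D (p + 1) q → d p z ∈ D p q
  δ_mem : ∀ {p q z}, z ∈ D p (q + 1) → δ p z ∈ D p q
  δ_zero : ∀ {p z}, z ∈ D p 0 → δ p z = 0
  ε_mem : ∀ {q z}, z ∈ D 0 q → ε z ∈ X q
  η_mem : ∀ {p z}, z ∈ D p 0 → η p z ∈ Y p
  δ_d : ∀ p z, δ p (d p z) = d p (δ (p + 1) z)
  ε_δ : ∀ z, ε (δ 0 z) = δX (ε z)
  η_d : ∀ p z, η p (d p z) = dY p (η (p + 1) z)
  η_δ : ∀ p z, η p (δ p z) = 0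
  ε_d : ∀ z, ε (d 0 z) = 0
  d_d : ∀ p z, d p (d (p + 1) z) = 0
  δ_δ : ∀ p z, δ p (δ p z) = 0
  ε_surj : ∀ {q x}, x ∈ X q → ∃ z ∈ D 0 q, ε z = x
  η_surj : ∀ {p y}, y ∈ Y p → ∃ z ∈ D p 0, η p z = y
  row_zero : ∀ {q z}, z ∈ D 0 q → ε z = 0 → ∃ y ∈ D 1 q, d 0 y = z
  row_succ : ∀ {p q z}, z ∈ D (p + 1) q → d p z = 0 → ∃ y ∈ D (p + 2) q, d (p + 1) y = z
  col_zero : ∀ {p z}, z ∈ D p 0 → η p z = 0 → ∃ y ∈ D p 1, δ p y = z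
  col_succ : ∀ {p q z}, z ∈ D p (q + 1) → δ p z = 0 → ∃ y ∈ D p (q + 2), δ p y = z

namespace AugmentedDoubleComplex

variable {k : Type*} [Field k] {V U : ℕ → Type*} {W : Type*}
    [∀ p, AddCommGroup (V p)] [∀ p, Module k (V p)] [∀ p, AddCommGroup (U p)]
    [∀ p, Module k (U p)] [AddCommGroup W] [Module k W]
    (E : AugmentedDoubleComplex k V U W)

/-- `E.Zig y p q z`: there is a zigzag `z = z_p, z_{p+1}, …, z_i` with `z_r` in position
`(r, i - r)`, `δ z_r = d z_{r+1}`, and `η z_i = y`; here `p + q = i`. -/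
inductive Zig {i : ℕ} (y : U i) : ∀ p : ℕ, ℕ → V p → Prop
  | base {z : V i} : z ∈ E.D i 0 → E.η i z = y → Zig y i 0 z
  | step {p q : ℕ} {z : V p} {z' : V (p + 1)} : z ∈ E.D p (q + 1) → E.δ p z = E.d p z' →
      Zig y (p + 1) q z' → Zig y p (q + 1) z

variable {E}

theorem Zig.mem {i : ℕ} {y : U i} {p q : ℕ} {z : V p} (h : E.Zig y p q z) : z ∈ E.D p q := by
  cases h with
  | base h _ => exact h
  | step h _ _ => exact h

theorem Zig.smul {i : ℕ} {y : U i} {p q : ℕ} {z : V p} (c : k) (h : E.Zig y p q z) :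
    E.Zig (c • y) p q (c • z) := by
  induction h with
  | base h h' => exact .base (Submodule.smul_mem _ _ h) (by rw [map_smul, h'])
  | step h h' _ ih => exact .step (Submodule.smul_mem _ _ h) (by rw [map_smul, map_smul, h']) ih

theorem Zig.add_eq {i : ℕ} {y : U i} {p q : ℕ} {z : V p} (h : E.Zig y p q z) : p + q = i := by
  induction h with
  | base h h' => rfl
  | step h h' _ ih => omega

theorem Zig.add {i : ℕ} {y y' : U i} {p q : ℕ} {z w : V p} (h : E.Zig y p q z)
    (hw : E.Zig y' p q w) : E.Zig (y + y') p q (z + w) := by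
  induction h with
  | base h h' =>
    cases hw with
    | base g g' => exact .base (Submodule.add_mem _ h g) (by rw [map_add, h', g'])
  | step h h' _ ih =>
    cases hw with
    | step g g' g'' =>
      exact .step (Submodule.add_mem _ h g) (by rw [map_add, map_add, h', g']) (ih g'')

theorem zig_zero {i : ℕ} (q : ℕ) : ∀ p, p + q = i → E.Zig (0 : U i) p q 0 := by
  induction q with
  | zero =>
    intro p hp
    obtain rfl : p = i := hp
    exact .base (Submodule.zero_mem _) (map_zero _)
  | succ q ih =>
    intro p hp
    exact .step (Submodule.zero_mem _) (by rw [map_zero, map_zero]) (ih (p + 1) (by omega))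

/-- A partial zigzag can be continued down to the column edge. -/
theorem exists_zig_down {i : ℕ} (q : ℕ) : ∀ (p : ℕ) (z : V p), p + q = i → z ∈ E.D p q →
    (∀ q', q = q' + 1 → ∃ z' ∈ E.D (p + 1) q', E.δ p z = E.d p z') →
    ∃ y ∈ E.Y i, E.Zig y p q z := by
  induction q with
  | zero =>
    intro p z hp hz _
    obtain rfl : p = i := hp
    exact ⟨_, E.η_mem hz, .base hz rfl⟩
  | succ q ih =>
    intro p z hp hz h
    obtain ⟨z', hz', h'⟩ := h q rfl
    obtain ⟨y, hy, hzig⟩ := ih (p + 1) z' (by omega) hz' (by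
      rintro q' rfl
      obtain ⟨w, hw, hw'⟩ := E.row_succ (E.δ_mem hz') (by rw [← E.δ_d, ← h', E.δ_δ])
      exact ⟨w, hw, hw'.symm⟩)
    exact ⟨y, hy, .step hz h' hzig⟩

/-- A partial zigzag can be continued up to the row edge. -/
theorem exists_zig_up {i : ℕ} {y : U i} (p : ℕ) : ∀ (q : ℕ) (z : V (p + 1)),
    E.Zig y (p + 1) q z → ∀ w ∈ E.D p (q + 1), E.δ p w = E.d p z →
    ∃ z₀, E.Zig y 0 i z₀ := by
  induction p with
  | zero =>
    intro q z h w hw h'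
    have := h.add_eq
    obtain rfl : q + 1 = i := by omega
    exact ⟨w, .step hw h' h⟩
  | succ p ih =>
    intro q z h w hw h'
    obtain ⟨w', hw', h''⟩ := E.col_succ (E.d_mem hw) (by rw [E.δ_d, h', E.d_d])
    exact ih (q + 1) w (.step hw h' h) w' hw' h''

/-- A zigzag of length at least one ends in a cycle. -/
theorem Zig.dY_eq_zero {i : ℕ} {y : U (i + 1)} (q : ℕ) :
    ∀ (p : ℕ) (z : V p), E.Zig y p (q + 1) z → E.dY i y = 0 := by
  induction q with
  | zero =>
    intro p z h
    cases h with
    | step h h' h'' =>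
      cases h'' with
      | base g g' => rw [← g', ← E.η_d, ← h', E.η_δ]
  | succ q ih =>
    intro p z h
    cases h with
    | step h h' h'' => exact ih _ _ h''

/-- If a zigzag starts in `δ u + d u'`, then it ends in a boundary of the column edge. -/
theorem Zig.mem_boundary {i : ℕ} {y : U i} {p q : ℕ} {z : V p} (h : E.Zig y p q z) :
    ∀ u ∈ E.D p (q + 1), ∀ u' ∈ E.D (p + 1) q, z = E.δ p u + E.d p u' →
      y ∈ (E.Y (i + 1)).map (E.dY i) := by
  induction h with
  | base h h' =>
    intro u hu u' hu' hz
    refine ⟨E.η _ u', E.η_mem hu', ?_⟩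
    rw [← h', hz, map_add, E.η_δ, E.η_d, zero_add]
  | step h h' h'' ih =>
    intro u hu u' hu' hz
    obtain ⟨w, hw, hw'⟩ := E.row_succ (Submodule.sub_mem _ h''.mem (E.δ_mem hu')) (by
      rw [map_sub, ← h', hz, map_add, E.δ_δ, zero_add, E.δ_d, sub_self])
    exact ih u' hu' w hw (by rw [hw']; abel)

/-- Conversely, if a zigzag ends in a boundary of the column edge, then it starts in some
`δ u + d u'`. -/
theorem Zig.exists_eq {i : ℕ} {y : U i} {p q : ℕ} {z : V p} (h : E.Zig y p q z)
    (hy : y ∈ (E.Y (i + 1)).map (E.dY i)) :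
    ∃ u ∈ E.D p (q + 1), ∃ u' ∈ E.D (p + 1) q, z = E.δ p u + E.d p u' := by
  induction h with
  | base h h' =>
    obtain ⟨y', hy', rfl⟩ := hy
    obtain ⟨u', hu', rfl⟩ := E.η_surj hy'
    obtain ⟨u, hu, hu''⟩ := E.col_zero (Submodule.sub_mem _ h (E.d_mem hu')) (by
      rw [map_sub, h', E.η_d, sub_self])
    exact ⟨u, hu, u', hu', by rw [hu'']; abel⟩
  | step h h' h'' ih =>
    obtain ⟨w, hw, w', hw', hz⟩ := ih
    obtain ⟨u, hu, hu'⟩ := E.col_succ (Submodule.sub_mem _ h (E.d_mem hw)) (by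
      rw [map_sub, h', E.δ_d, hz, map_add, E.d_d, add_zero, sub_self])
    exact ⟨u, hu, w, hw, by rw [hu']; abel⟩

/-- The `Y`-cycles; in degree `0` every element is one. -/
def cyclesY (E : AugmentedDoubleComplex k V U W) : ∀ i, Submodule k (U i)
  | 0 => E.Y 0
  | i + 1 => E.Y (i + 1) ⊓ LinearMap.ker (E.dY i)

variable (E) in
/-- The two edge complexes of an augmented double complex with exact rows and columns have the same
homology. -/
theorem homologyDim_edges (i : ℕ) :
    homologyDim (E.X i ⊓ LinearMap.ker E.δX) ((E.X (i + 1)).map E.δX) =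
      homologyDim (E.cyclesY i) ((E.Y (i + 1)).map (E.dY i)) := by
  -- `x` and `y` are related if they are the two ends of a zigzag
  let R : Submodule k (W × U i) :=
    { carrier := {x | ∃ z, E.Zig x.2 0 i z ∧ E.ε z = x.1}
      zero_mem' := ⟨0, zig_zero i 0 (zero_add i), map_zero _⟩
      add_mem' := by
        rintro ⟨x, y⟩ ⟨x', y'⟩ ⟨z, hz, h⟩ ⟨z', hz', h'⟩
        exact ⟨z + z', hz.add hz', by rw [map_add, h, h']; rfl⟩
      smul_mem' := by
        rintro c ⟨x, y⟩ ⟨z, hz, h⟩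
        exact ⟨c • z, hz.smul c, by rw [map_smul, h]; rfl⟩ }
  refine homologyDim_eq_of_relation R ?_ ?_ ?_
  · rintro x ⟨hx, hx'⟩
    obtain ⟨z, hz, rfl⟩ := E.ε_surj hx
    obtain ⟨y, hy, hzig⟩ := exists_zig_down i 0 z (zero_add i) hz (by
      rintro q' rfl
      obtain ⟨w, hw, hw'⟩ := E.row_zero (E.δ_mem hz) (by rw [E.ε_δ]; exact hx')
      exact ⟨w, hw, hw'.symm⟩)
    refine ⟨y, ?_, z, hzig, rfl⟩
    cases i with
    | zero => exact hy
    | succ i => exact ⟨hy, hzig.dY_eq_zero⟩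
  · intro y hy
    have hyY : y ∈ E.Y i := by
      cases i with
      | zero => exact hy
      | succ i => exact hy.1
    obtain ⟨z, hz, hzy⟩ := E.η_surj hyY
    obtain ⟨z₀, hz₀⟩ : ∃ z₀, E.Zig y 0 i z₀ := by
      cases i with
      | zero => exact ⟨z, .base hz hzy⟩
      | succ i =>
        obtain ⟨w, hw, hw'⟩ := E.col_zero (E.d_mem hz) (by rw [E.η_d, hzy]; exact hy.2)
        exact exists_zig_up i 0 z (.base hz hzy) w hw hw'
    refine ⟨E.ε z₀, ⟨E.ε_mem hz₀.mem, ?_⟩, z₀, hz₀, rfl⟩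
    rw [SetLike.mem_coe, LinearMap.mem_ker, ← E.ε_δ]
    cases hz₀ with
    | base h _ => rw [E.δ_zero h, map_zero]
    | step h h' _ => rw [h', E.ε_d]
  · rintro x - y - ⟨z, hz, rfl⟩
    constructor
    · rintro ⟨x', hx', h⟩
      obtain ⟨u, hu, rfl⟩ := E.ε_surj hx'
      obtain ⟨w, hw, hw'⟩ := E.row_zero (Submodule.sub_mem _ hz.mem (E.δ_mem hu)) (by
        rw [map_sub, E.ε_δ, h, sub_self])
      exact hz.mem_boundary u hu w hw (by rw [hw']; abel)
    · intro hy
      obtain ⟨u, hu, u', hu', h⟩ := hz.exists_eq hy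
      exact ⟨E.ε u, E.ε_mem hu, by simp only [h, map_add, E.ε_d, E.ε_δ, add_zero]⟩

end AugmentedDoubleComplex

/-! ### Signs -/

section Signs

variable {k : Type*} [Field k] {n : ℕ}

theorem sgnElt_mul_self (w : Fin n) (L : Finset (Fin n)) : sgnElt k w L * sgnElt k w L = 1 := by
  rw [sgnElt, ← mul_pow]; simp

theorem sgnSet_mul_self (W L : Finset (Fin n)) : sgnSet k W L * sgnSet k W L = 1 := by
  rw [sgnSet, ← Finset.prod_mul_distrib]
  exact Finset.prod_eq_one fun w _ => sgnElt_mul_self w L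

theorem sgnSet_ne_zero (W L : Finset (Fin n)) : sgnSet k W L ≠ 0 :=
  left_ne_zero_of_mul_eq_one (sgnSet_mul_self W L)

theorem sgnSet_insert {w : Fin n} {W : Finset (Fin n)} (hw : w ∉ W) (L : Finset (Fin n)) :
    sgnSet k (insert w W) L = sgnElt k w L * sgnSet k W L :=
  Finset.prod_insert hw

theorem sgnElt_insert_self (w : Fin n) (L : Finset (Fin n)) :
    sgnElt k w (insert w L) = sgnElt k w L := by
  rw [sgnElt, sgnElt, Finset.filter_insert, if_neg (lt_irrefl w)]

theorem sgnElt_insert {t : Fin n} {L : Finset (Fin n)} (ht : t ∉ L) (u : Fin n) :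
    sgnElt k u (insert t L) = (if t < u then -1 else 1) * sgnElt k u L := by
  rw [sgnElt, sgnElt, Finset.filter_insert]
  split_ifs with h
  · rw [Finset.card_insert_of_notMem (by simp [ht]), pow_succ, mul_comm]
  · rw [one_mul]

/-- The sign identity behind the comparison with the Koszul complex: the elements of `S` below `w`
are those of `S \ τ` and those of `τ`. -/
theorem sgnElt_sdiff_mul {S τ : Finset (Fin n)} (h : τ ⊆ S) (w : Fin n) :
    sgnElt k w (S \ τ) * sgnElt k w τ = sgnElt k w S := by
  rw [sgnElt, sgnElt, sgnElt, ← pow_add, ← Finset.card_union_of_disjoint, ← Finset.filter_union,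
    Finset.sdiff_union_of_subset h]
  exact Finset.disjoint_filter_filter Finset.sdiff_disjoint

/-- The two orders of removing a pair `t ≠ u` contribute with opposite signs. -/
theorem sgnElt_mul_sgnElt_insert {t u : Fin n} (htu : t ≠ u) {L : Finset (Fin n)} (ht : t ∉ L)
    (hu : u ∉ L) :
    sgnElt k t (insert t L) * sgnElt k u (insert u (insert t L)) =
      -(sgnElt k u (insert u L) * sgnElt k t (insert t (insert u L))) := by
  simp only [sgnElt_insert_self, sgnElt_insert ht u, sgnElt_insert hu t]
  rcases lt_or_gt_of_ne htu with h | h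
  · rw [if_pos h, if_neg h.not_gt]; ring
  · rw [if_neg h.not_gt, if_pos h]; ring

end Signs

/-! ### Koszul complexes -/

section Koszul

variable {k : Type*} [Field k] {n : ℕ} {N N' : Type*} [AddCommGroup N] [Module k N]
  [Module (MvPolynomial (Fin n) k) N] [IsScalarTower k (MvPolynomial (Fin n) k) N]
  [AddCommGroup N'] [Module k N'] [Module (MvPolynomial (Fin n) k) N']
  [IsScalarTower k (MvPolynomial (Fin n) k) N']

variable (k) in
/-- The Koszul differential of `N ⊗ K_•` for an arbitrary module `N` over the polynomial ring. -/
def koszulMap : (Finset (Fin n) → N) →ₗ[k] (Finset (Fin n) → N) where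
  toFun f L := ∑ t ∈ Finset.univ.filter fun t => t ∉ L,
    (C (sgnElt k t (insert t L)) * X t : MvPolynomial (Fin n) k) • f (insert t L)
  map_add' f g := by
    funext L
    simp only [Pi.add_apply, smul_add, Finset.sum_add_distrib]
  map_smul' c f := by
    funext L
    simp only [Pi.smul_apply, Finset.smul_sum, RingHom.id_apply]
    exact Finset.sum_congr rfl fun t _ => smul_algebra_smul_comm _ _ _

theorem koszulMap_apply (f : Finset (Fin n) → N) (L : Finset (Fin n)) :
    koszulMap k f L = ∑ t ∈ Finset.univ.filter fun t => t ∉ L,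
      (C (sgnElt k t (insert t L)) * X t : MvPolynomial (Fin n) k) • f (insert t L) := rfl

/-- The Koszul differential is natural in the module. -/
theorem koszulMap_comp (T : N →ₗ[MvPolynomial (Fin n) k] N') (f : Finset (Fin n) → N) :
    koszulMap k (fun L => T (f L)) = fun L => T (koszulMap k f L) := by
  funext L
  simp only [koszulMap_apply, map_sum, map_smul]

theorem koszulMap_single (L : Finset (Fin n)) (x : N) :
    koszulMap k (Pi.single L x) = ∑ w ∈ L,
      Pi.single (L.erase w) ((C (sgnElt k w L) * X w : MvPolynomial (Fin n) k) • x) := by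
  funext L'
  rw [koszulMap_apply, Finset.sum_apply, Finset.sum_filter,
    ← Finset.sum_subset (Finset.subset_univ L)]
  · refine Finset.sum_congr rfl fun t ht => ?_
    by_cases h : L' = L.erase t
    · subst h
      simp [Finset.insert_erase ht]
    · rw [Pi.single_eq_of_ne h]
      split_ifs with h'
      · rfl
      · rw [Pi.single_eq_of_ne, smul_zero]
        rintro rfl
        exact h (Finset.erase_insert h').symm
  · intro t _ ht
    split_ifs with h'
    · rfl
    · rw [Pi.single_eq_of_ne, smul_zero]
      rintro rfl
      exact ht (Finset.mem_insert_self _ _)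

theorem koszulMap_koszulMap (f : Finset (Fin n) → N) : koszulMap k (koszulMap k f) = 0 := by
  funext L
  rw [koszulMap_apply, Pi.zero_apply]
  simp only [koszulMap_apply, Finset.smul_sum, smul_smul]
  rw [Finset.sum_sigma']
  -- the summands for `(t, u)` and `(u, t)` cancel
  refine Finset.sum_involution (fun x _ => ⟨x.2, x.1⟩) ?_ ?_ ?_ ?_
  · rintro ⟨t, u⟩ h
    simp only [Finset.mem_sigma, Finset.mem_filter, Finset.mem_univ, true_and, Finset.mem_insert,
      not_or] at h
    dsimp only
    rw [Finset.insert_comm t u, ← add_smul]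
    have h1 := sgnElt_mul_sgnElt_insert (k := k) (Ne.symm h.2.1) h.1 h.2.2
    rw [Finset.insert_comm t u] at h1
    have h2 := congrArg (C : k → MvPolynomial (Fin n) k) h1
    rw [map_neg, map_mul, map_mul] at h2
    refine (congrArg (fun r => r • f (insert u (insert t L))) ?_).trans
      (zero_smul (MvPolynomial (Fin n) k) _)
    linear_combination (X t * X u : MvPolynomial (Fin n) k) * h2
  · rintro ⟨t, u⟩ h - h'
    simp only [Finset.mem_sigma, Finset.mem_filter, Finset.mem_univ, true_and, Finset.mem_insert,
      not_or] at h
    simp only [Sigma.mk.injEq, heq_eq_eq] at h'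
    exact h.2.1 h'.1
  · rintro ⟨t, u⟩ h
    simp only [Finset.mem_sigma, Finset.mem_filter, Finset.mem_univ, true_and, Finset.mem_insert,
      not_or] at h ⊢
    exact ⟨h.2.2, Ne.symm h.2.1, h.1⟩
  · rintro ⟨t, u⟩ _
    rfl

end Koszul

namespace MonMatrix

variable {k : Type*} [Field k] {n s l : ℕ} {A : MonMatrix k n s l} {γ : Fin l → MDeg n}
  {β : Fin s → MDeg n} {m : MonomialOrder (Fin n)}

/-! ### The Koszul complex of `M_A` in the basis of standard monomials -/

/-- The element `x^{α - L - β_j} v_j ⊗ e_L` of `M_A ⊗ K_•`, of degree `α`. -/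
def kElt (A : MonMatrix k n s l) (β : Fin s → MDeg n) (α : MDeg n) (j : Fin s)
    (L : Finset (Fin n)) : Finset (Fin n) → A.Coker :=
  Pi.single L (A.im.mkQ (Pi.single j (mMon k (α - mInd L - β j))))

theorem koszul_kElt {α : MDeg n} {j : Fin s} {L : Finset (Fin n)}
    (h : 0 ≤ α - mInd L - β j) :
    A.koszul (A.kElt β α j L) = ∑ w ∈ L, sgnElt k w L • A.kElt β α j (L.erase w) := by
  rw [kElt]
  refine (koszulMap_single _ _).trans ?_
  refine Finset.sum_congr rfl fun w hw => ?_
  rw [kElt, ← Pi.single_smul, ← mkQ_smul, sub_mInd_erase hw, add_sub_assoc,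
    ← mMon_mul (mInd_nonneg _) h, mMon_mInd, Finset.prod_singleton, ← map_smul]
  congr 2
  rw [mul_smul, ← algebraMap_eq, algebraMap_smul, ← Pi.single_smul, smul_eq_mul]

/-- The cochain `(j, τ)^*` of `C^•(A, α)` corresponds to the standard monomial
`x^{α - L - β_j} v_j` of degree `α - L`, where `L = σ_{α_j} \ τ`. -/
theorem mem_cplxAt_iff {α : MDeg n} {j : Fin s} {τ : Finset (Fin n)}
    (hτ : τ ⊆ mSupp (α - β j)) :
    τ ∈ A.cplxAt β m j α ↔ A.IsStd β m (α - mInd (mSupp (α - β j) \ τ)) j := by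
  constructor
  · rintro ⟨h1, -, h2⟩
    exact ⟨sub_mInd_nonneg h1 Finset.sdiff_subset, by rwa [mSupp_sub_mInd_sdiff h1 hτ]⟩
  · rintro ⟨h1, h2⟩
    have h := (subset_mSupp_of_nonneg h1).1
    exact ⟨h, hτ, by rwa [mSupp_sub_mInd_sdiff h hτ] at h2⟩

/-- Rewriting a nonstandard monomial in terms of standard ones. -/
theorem kElt_eq_sum (hT : A.IsSquarefreeSolution γ β) (m : MonomialOrder (Fin n)) {α : MDeg n}
    {j : Fin s} {τ : Finset (Fin n)} (hα : 0 ≤ α - β j) (hτ : τ ⊆ mSupp (α - β j))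
    (hn : τ ∉ A.cplxAt β m j α) :
    A.kElt β α j (mSupp (α - β j) \ τ) =
      ∑ i, A.red β m j i (mInd τ + (α - β j) - mSqf (α - β j)) •
        A.kElt β α i (mSupp (α - β j) \ τ) := by
  rw [mInd_add_sub_mSqf hτ]
  have h0 := sub_mInd_nonneg hα (Finset.sdiff_subset (s := mSupp (α - β j)) (t := τ))
  have h := (isReduction_red hT m h0 fun h => hn ((mem_cplxAt_iff hτ).2 ⟨h0, h⟩)).2
  rw [kElt, h]
  simp only [kElt, ← Pi.single_smul, sub_add_cancel]
  exact map_sum (LinearMap.single k (fun _ => A.Coker) (mSupp (α - β j) \ τ)) _ _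

/-- Only standard monomials occur in a reduction. -/
theorem red_ne_zero (hT : A.IsSquarefreeSolution γ β) {α : MDeg n} {j i : Fin s}
    {τ : Finset (Fin n)} (hα : 0 ≤ α - β j) (hτ : τ ⊆ mSupp (α - β j))
    (hn : τ ∉ A.cplxAt β m j α)
    (hr : A.red β m j i (mInd τ + (α - β j) - mSqf (α - β j)) ≠ 0) :
    i < j ∧ A.IsStd β m (α - mInd (mSupp (α - β j) \ τ)) i := by
  rw [mInd_add_sub_mSqf hτ] at hr
  have h0 := sub_mInd_nonneg hα (Finset.sdiff_subset (s := mSupp (α - β j)) (t := τ))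
  have h := (isReduction_red hT m h0 fun h => hn ((mem_cplxAt_iff hτ).2 ⟨h0, h⟩)).1 i hr
  rwa [sub_add_cancel] at h

/-- A set `L` carrying a standard monomial corresponds to the face `σ_{α_j} \ L`. -/
theorem sdiff_mem_cplxAt {α : MDeg n} {j : Fin s} {L : Finset (Fin n)}
    (h : A.IsStd β m (α - mInd L) j) :
    L ⊆ mSupp (α - β j) ∧ mSupp (α - β j) \ L ∈ A.cplxAt β m j α := by
  have hL := (subset_mSupp_of_nonneg h.1).2
  refine ⟨hL, (mem_cplxAt_iff Finset.sdiff_subset).2 ?_⟩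
  rwa [Finset.sdiff_sdiff_eq_self hL]

/-! ### The comparison of `C^•(A, α)` with the Koszul complex -/

/-- The linear map `(j, τ)^* ↦ sgn[τ, σ_{α_j}] x^{α_j - L} v_j ⊗ e_L` with `L = σ_{α_j} \ τ`; the
sign turns the Koszul signs `sgn[w, L]` into the simplicial signs `sgn[w, τ ∪ w]`. -/
def theta (A : MonMatrix k n s l) (β : Fin s → MDeg n) (α : MDeg n) :
    Amb k n s →ₗ[k] (Finset (Fin n) → A.Coker) :=
  Finsupp.linearCombination k fun b =>
    sgnSet k b.2 (mSupp (α - β b.1)) • A.kElt β α b.1 (mSupp (α - β b.1) \ b.2)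

theorem theta_single (α : MDeg n) (j : Fin s) (τ : Finset (Fin n)) (c : k) :
    A.theta β α (Finsupp.single (j, τ) c) =
      (c * sgnSet k τ (mSupp (α - β j))) • A.kElt β α j (mSupp (α - β j) \ τ) := by
  rw [theta, Finsupp.linearCombination_single, smul_smul]

/-- All cochains of `C^•(A, α)`, of any cohomological degree. -/
def allCochains (A : MonMatrix k n s l) (β : Fin s → MDeg n) (m : MonomialOrder (Fin n))
    (α : MDeg n) : Submodule k (Amb k n s) :=
  Finsupp.supported k k {b | b.2 ∈ A.cplxAt β m b.1 α}

theorem cochains_le_allCochains [NeZero s] (α : MDeg n) (t : ℤ) :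
    A.cochains β m α t ≤ A.allCochains β m α :=
  Finsupp.supported_mono fun _ h => h.1

/-- A property of cochains stable under linear combinations holds if it holds on the basis. -/
theorem supported_le_of_single {S : Set (Fin s × Finset (Fin n))} {N : Submodule k (Amb k n s)}
    (h : ∀ j τ, (j, τ) ∈ S → Finsupp.single (j, τ) 1 ∈ N) : Finsupp.supported k k S ≤ N := by
  rw [Finsupp.supported_eq_span_single, Submodule.span_le]
  rintro _ ⟨⟨j, τ⟩, hb, rfl⟩
  exact h j τ hb

theorem delta_single (α : MDeg n) (j : Fin s) (τ : Finset (Fin n)) :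
    A.delta β m α (Finsupp.single (j, τ) 1) = A.dBasis β m α j τ + A.chiBasis β m α j τ := by
  rw [delta, Finsupp.linearCombination_single, one_smul]

theorem map_delta_cochains_le [NeZero s] (hT : A.IsSquarefreeSolution γ β) (α : MDeg n) (t : ℤ) :
    (A.cochains β m α t).map (A.delta β m α) ≤ A.cochains β m α (t + 1) := by
  classical
  rw [Submodule.map_le_iff_le_comap]
  refine supported_le_of_single fun j τ hb => ?_
  obtain ⟨hτ, hcard⟩ := hb
  dsimp only at hτ hcard
  rw [Submodule.mem_comap, delta_single]
  refine Submodule.add_mem _ ?_ ?_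
  · rw [dBasis]
    refine Submodule.sum_mem _ fun w hw => Finsupp.single_mem_supported _ _ ?_
    simp only [Finset.mem_filter, Finset.mem_univ, true_and] at hw
    refine ⟨hw.2, ?_⟩
    dsimp only
    rw [Finset.card_insert_of_notMem hw.1]
    push_cast; linarith
  · rw [chiBasis]
    refine Submodule.sum_mem _ fun w hw => Submodule.sum_mem _ fun i hi => ?_
    simp only [Finset.mem_filter, Finset.mem_sdiff] at hw
    have hτ' : insert w τ ⊆ mSupp (α - β j) := Finset.insert_subset hw.1.1 hτ.2.1
    by_cases hr : A.red β m j i (mInd (insert w τ) + (α - β j) - mSqf (α - β j)) = 0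
    · rw [hr]; simp
    refine Finsupp.single_mem_supported _ _ ?_
    obtain ⟨h1, h2⟩ := sdiff_mem_cplxAt (red_ne_zero hT hτ.1 hτ' hw.2 hr).2
    refine ⟨h2, ?_⟩
    have e1 := Finset.card_sdiff_add_card_eq_card h1
    have e2 := Finset.card_sdiff_add_card_eq_card hτ'
    rw [Finset.card_insert_of_notMem hw.1.2] at e2
    dsimp only [transfer]
    zify at e1 e2
    linarith

/-- `theta` intertwines `δ` with the Koszul differential. -/
theorem koszul_theta (hT : A.IsSquarefreeSolution γ β) {α : MDeg n} {c : Amb k n s}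
    (hc : c ∈ A.allCochains β m α) :
    A.koszul (A.theta β α c) = A.theta β α (A.delta β m α c) := by
  classical
  have hle : A.allCochains β m α ≤
      LinearMap.eqLocus (A.koszul ∘ₗ A.theta β α) (A.theta β α ∘ₗ A.delta β m α) := by
    refine supported_le_of_single fun j τ hτ => ?_
    replace hτ : τ ∈ A.cplxAt β m j α := hτ
    obtain ⟨h0, hτS, -⟩ := id hτ
    set S := mSupp (α - β j) with hS
    rw [LinearMap.mem_eqLocus, LinearMap.comp_apply, LinearMap.comp_apply, theta_single, one_mul,
      map_smul, koszul_kElt (sub_mInd_nonneg h0 Finset.sdiff_subset), delta_single, map_add,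
      Finset.smul_sum, dBasis, chiBasis, map_sum, map_sum,
      ← Finset.sum_filter_add_sum_filter_not (S \ τ) (fun w => insert w τ ∈ A.cplxAt β m j α)]
    -- removing `w` from `L = S \ τ` adds it to `τ`; the rescaling accounts for the change of sign
    have key : ∀ w ∈ S \ τ, sgnSet k τ S • sgnElt k w (S \ τ) • A.kElt β α j ((S \ τ).erase w) =
        (sgnElt k w (insert w τ) * sgnSet k (insert w τ) S) •
          A.kElt β α j (S \ insert w τ) := by
      intro w hw
      rw [Finset.mem_sdiff] at hw
      rw [smul_smul, Finset.sdiff_insert, sgnSet_insert hw.2, sgnElt_insert_self,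
        ← sgnElt_sdiff_mul hτS w]
      congr 1
      linear_combination -(sgnSet k τ S * sgnElt k w (S \ τ)) * sgnElt_mul_self (k := k) w τ
    congr 1
    · refine Finset.sum_congr ?_ fun w hw => ?_
      · ext w
        simp only [Finset.mem_filter, Finset.mem_sdiff, Finset.mem_univ, true_and]
        refine ⟨fun h => ⟨h.1.2, h.2⟩, fun h => ⟨⟨h.2.2.1 (Finset.mem_insert_self _ _), h.1⟩, h.2⟩⟩
      · have hw' := (Finset.mem_filter.1 hw).2
        rw [key w (Finset.mem_sdiff.2 ⟨hw'.2.2.1 (Finset.mem_insert_self _ _), hw'.1⟩),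
          theta_single]
    · refine Finset.sum_congr rfl fun w hw => ?_
      rw [key w (Finset.mem_of_mem_filter _ hw)]
      simp only [Finset.mem_filter, Finset.mem_sdiff] at hw
      have hτ' : insert w τ ⊆ S := Finset.insert_subset hw.1.1 hτS
      rw [kElt_eq_sum hT m h0 hτ' hw.2, map_sum, Finset.smul_sum, Finset.sum_filter]
      refine Finset.sum_congr rfl fun i _ => ?_
      by_cases hr : A.red β m j i (mInd (insert w τ) + (α - β j) - mSqf (α - β j)) = 0
      · simp [hr]
      obtain ⟨hij, hstd⟩ := red_ne_zero hT h0 hτ' hw.2 hr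
      rw [if_pos hij, theta_single, smul_smul, transfer, Finset.sdiff_sdiff_eq_self
        (sdiff_mem_cplxAt hstd).1]
      congr 1
      rw [mul_assoc _ (_ / _), div_mul_cancel₀ _ (sgnSet_ne_zero _ _)]
      ring
  exact hle hc

/-- The `e_L`-component of `theta c` is the class of an explicit combination of standard monomials,
the coefficient of `v_j` coming from the face `σ_{α_j} \ L`. -/
theorem theta_apply {α : MDeg n} {c : Amb k n s} (hc : c ∈ A.allCochains β m α)
    (L : Finset (Fin n)) :
    A.theta β α c L = A.im.mkQ (∑ j, (if L ⊆ mSupp (α - β j) then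
      c (j, mSupp (α - β j) \ L) * sgnSet k (mSupp (α - β j) \ L) (mSupp (α - β j)) else 0) •
        Pi.single j (mMon k (α - mInd L - β j))) := by
  classical
  rw [map_sum]
  simp only [mkQ_smul]
  let T : Amb k n s →ₗ[k] A.Coker := ∑ j, (if L ⊆ mSupp (α - β j) then
      sgnSet k (mSupp (α - β j) \ L) (mSupp (α - β j)) • (Finsupp.lapply (j, mSupp (α - β j) \ L))
        else 0 : Amb k n s →ₗ[k] k).smulRight (A.im.mkQ (Pi.single j (mMon k (α - mInd L - β j))))
  have hle : A.allCochains β m α ≤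
      LinearMap.eqLocus (LinearMap.proj L ∘ₗ A.theta β α) T := by
    refine supported_le_of_single fun j τ hτ => ?_
    obtain ⟨h0, hτS, -⟩ := hτ
    dsimp only at hτS
    rw [LinearMap.mem_eqLocus, LinearMap.comp_apply, theta_single, one_mul, LinearMap.proj_apply,
      Pi.smul_apply, kElt, LinearMap.sum_apply, Finset.sum_eq_single j]
    · by_cases hL : L = mSupp (α - β j) \ τ
      · subst hL
        rw [Pi.single_eq_same, LinearMap.smulRight_apply, if_pos Finset.sdiff_subset,
          Finset.sdiff_sdiff_eq_self hτS]
        simp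
      · rw [Pi.single_eq_of_ne hL, smul_zero, LinearMap.smulRight_apply]
        split_ifs with h
        · rw [LinearMap.smul_apply, Finsupp.lapply_apply, Finsupp.single_eq_of_ne]
          · simp
          · intro h'
            apply hL
            rw [← (Prod.mk.inj h').2, Finset.sdiff_sdiff_eq_self h]
        · simp
    · intro i _ hij
      rw [LinearMap.smulRight_apply]
      split_ifs with h
      · rw [LinearMap.smul_apply, Finsupp.lapply_apply, Finsupp.single_eq_of_ne]
        · simp
        · intro h'
          exact hij (Prod.mk.inj h').1
      · simp
    · simp
  have := hle hc
  rw [LinearMap.mem_eqLocus, LinearMap.comp_apply, LinearMap.proj_apply] at this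
  rw [this, LinearMap.sum_apply]
  refine Finset.sum_congr rfl fun j _ => ?_
  rw [LinearMap.smulRight_apply]
  split_ifs with h
  · rw [LinearMap.smul_apply, Finsupp.lapply_apply, smul_eq_mul, mul_comm]
  · simp

/-- `theta` is injective on cochains because standard monomials are independent. -/
theorem theta_injective (hT : A.IsSquarefreeSolution γ β) {α : MDeg n} {c : Amb k n s}
    (hc : c ∈ A.allCochains β m α) (h : A.theta β α c = 0) : c = 0 := by
  classical
  refine Finsupp.ext fun ⟨j, τ⟩ => ?_
  by_contra hne
  have hτ : τ ∈ A.cplxAt β m j α := hc (Finsupp.mem_support_iff.2 hne)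
  set L := mSupp (α - β j) \ τ with hL
  set e : Fin s → k := fun j => if L ⊆ mSupp (α - β j) then
      c (j, mSupp (α - β j) \ L) * sgnSet k (mSupp (α - β j) \ L) (mSupp (α - β j)) else 0 with he
  have hf : ∀ i, (∑ j, e j • Pi.single j (mMon k (α - mInd L - β j)) :
      Fin s → MvPolynomial (Fin n) k) i = e i • mMon k (α - mInd L - β i) := by
    intro i
    rw [Finset.sum_apply, Finset.sum_eq_single i (fun j _ h => by
      simp [Pi.single_eq_of_ne h.symm]) (by simp)]
    simp
  have h1 := theta_apply hc L
  rw [h, Pi.zero_apply, eq_comm, Submodule.mkQ_apply, Submodule.Quotient.mk_eq_zero] at h1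
  have h2 := eq_zero_of_isStd hT (m := m) h1 (mem_freePart_iff.2 fun i => ⟨_, hf i⟩) fun i hi => by
    have hei : e i ≠ 0 := fun h0 => hi (by rw [hf, h0, zero_smul])
    simp only [he] at hei
    split_ifs at hei with hLi
    · have := hc (Finsupp.mem_support_iff.2 (left_ne_zero_of_mul hei))
      have h3 := (mem_cplxAt_iff Finset.sdiff_subset).1 this
      rwa [Finset.sdiff_sdiff_eq_self hLi] at h3
    · exact absurd rfl hei
  have h3 := congrFun h2 j
  rw [hf, Pi.zero_apply, smul_eq_zero] at h3
  have h4 := h3.resolve_right (mMon_ne_zero ((mem_cplxAt_iff hτ.2.1).1 hτ).1)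
  rw [he] at h4
  dsimp only at h4
  rw [if_pos Finset.sdiff_subset, hL, Finset.sdiff_sdiff_eq_self hτ.2.1] at h4
  exact hne ((mul_eq_zero.1 h4).resolve_right (sgnSet_ne_zero _ _))

/-- `theta` maps `C^t(A, α)` onto `(M_A ⊗ K_i)_α` for `t = |σ_{α_1}| - i - 1`. -/
theorem map_theta_cochains [NeZero s] (hT : A.IsSquarefreeSolution γ β) (α : MDeg n) (i : ℕ) :
    (A.cochains β m α ((mSupp (α - β 0)).card - i - 1)).map (A.theta β α) =
      A.koszulPart β α i := by
  classical
  apply le_antisymm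
  · rw [Submodule.map_le_iff_le_comap]
    refine supported_le_of_single fun j τ hb => ?_
    obtain ⟨hτ, hcard⟩ := hb
    dsimp only at hτ hcard
    rw [Submodule.mem_comap, theta_single]
    refine Submodule.smul_mem _ _ ?_
    rw [koszulPart, Submodule.mem_pi]
    intro L _
    by_cases hL : L = mSupp (α - β j) \ τ
    · rw [if_pos, kElt, hL, Pi.single_eq_same]
      · exact ⟨_, single_mMon_mem_freePart β _ j, rfl⟩
      · have := Finset.card_sdiff_add_card_eq_card hτ.2.1
        rw [hL]
        omega
    · rw [kElt, Pi.single_eq_of_ne hL]; exact Submodule.zero_mem _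
  · intro x hx
    rw [koszulPart, Submodule.mem_pi] at hx
    rw [← Finset.univ_sum_single x]
    refine Submodule.sum_mem _ fun L _ => ?_
    have hxL := hx L (Set.mem_univ _)
    split_ifs at hxL with hL
    swap
    · rw [(Submodule.mem_bot k).1 hxL, Pi.single_zero]; exact Submodule.zero_mem _
    obtain ⟨f, hf, hfx⟩ := hxL
    obtain ⟨g, hg, hg1, hg2⟩ := exists_normalForm hT m s f hf fun j hj =>
      absurd j.2 (not_lt.2 hj)
    have hgx : x L = A.im.mkQ g := by
      rw [← hfx]
      exact sub_eq_zero.1 (by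
        rw [LinearMap.restrictScalars_apply, ← map_sub]
        exact (Submodule.Quotient.mk_eq_zero _).2 hg2)
    choose c hc using mem_freePart_iff.1 hg
    have : Pi.single L (x L) = ∑ j, if g j = 0 then 0 else c j • A.kElt β α j L := by
      have hsum : A.im.mkQ g = ∑ j, A.im.mkQ (Pi.single j (g j)) := by
        conv_lhs => rw [← Finset.univ_sum_single g, map_sum]
      rw [hgx, hsum]
      have := map_sum (LinearMap.single k (fun _ => A.Coker) L)
        (fun j => A.im.mkQ (Pi.single j (g j))) Finset.univ
      simp only [LinearMap.coe_single] at this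
      rw [this]
      refine Finset.sum_congr rfl fun j _ => ?_
      split_ifs with h
      · rw [h]; simp
      · rw [hc j, Pi.single_smul, mkQ_smul, Pi.single_smul, kElt]
    rw [this]
    refine Submodule.sum_mem _ fun j _ => ?_
    split_ifs with h
    · exact Submodule.zero_mem _
    obtain ⟨hLS, hcp⟩ := sdiff_mem_cplxAt (hg1 j h).1
    refine ⟨Finsupp.single (j, mSupp (α - β j) \ L)
      (c j * sgnSet k (mSupp (α - β j) \ L) (mSupp (α - β j))),
      Finsupp.single_mem_supported _ _ ⟨hcp, ?_⟩, ?_⟩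
    · have := Finset.card_sdiff_add_card_eq_card hLS
      dsimp only
      omega
    · rw [theta_single, mul_assoc, sgnSet_mul_self, mul_one, Finset.sdiff_sdiff_eq_self hLS]

theorem delta_delta [NeZero s] (hT : A.IsSquarefreeSolution γ β) (α : MDeg n) (t : ℤ)
    {c : Amb k n s} (hc : c ∈ A.cochains β m α t) :
    A.delta β m α (A.delta β m α c) = 0 := by
  have h1 := map_delta_cochains_le (m := m) hT α t ⟨c, hc, rfl⟩
  have h2 := map_delta_cochains_le (m := m) hT α _ ⟨_, h1, rfl⟩
  refine theta_injective hT (cochains_le_allCochains _ _ h2) ?_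
  rw [← koszul_theta hT (cochains_le_allCochains _ _ h1),
    ← koszul_theta hT (cochains_le_allCochains _ _ hc)]
  exact koszulMap_koszulMap _

theorem koszulDim_eq_cohomologyDim [NeZero s] (hT : A.IsSquarefreeSolution γ β)
    (m : MonomialOrder (Fin n)) (α : MDeg n) (i : ℕ) :
    A.koszulDim β α i = A.cohomologyDim β m α ((mSupp (α - β 0)).card - i - 1) := by
  have hi := map_theta_cochains (m := m) hT α i
  have hi1 := map_theta_cochains (m := m) hT α (i + 1)
  rw [show ((mSupp (α - β 0)).card - ((i + 1 : ℕ) : ℤ) - 1 : ℤ) =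
    (mSupp (α - β 0)).card - i - 1 - 1 by push_cast; ring] at hi1
  set t : ℤ := (mSupp (α - β 0)).card - i - 1 with ht
  symm
  refine homologyDim_eq_of_relation (LinearMap.graph (A.theta β α)) ?_ ?_ ?_
  · rintro c ⟨hc, hc'⟩
    refine ⟨A.theta β α c, ⟨hi ▸ ⟨c, hc, rfl⟩, ?_⟩, rfl⟩
    rw [SetLike.mem_coe, LinearMap.mem_ker] at hc' ⊢
    rw [koszul_theta hT (cochains_le_allCochains _ _ hc), hc', map_zero]
  · rintro x ⟨hx, hx'⟩
    rw [SetLike.mem_coe, ← hi] at hx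
    obtain ⟨c, hc, rfl⟩ := hx
    refine ⟨c, ⟨hc, ?_⟩, rfl⟩
    rw [SetLike.mem_coe, LinearMap.mem_ker,
      koszul_theta hT (cochains_le_allCochains _ _ hc)] at hx'
    exact theta_injective hT (cochains_le_allCochains _ _
      (map_delta_cochains_le (m := m) hT α t ⟨c, hc, rfl⟩)) hx'
  · rintro c ⟨hc, -⟩ x - hcx
    obtain rfl : x = A.theta β α c := hcx
    constructor
    · rintro ⟨b, hb, rfl⟩
      exact ⟨A.theta β α b, hi1 ▸ ⟨b, hb, rfl⟩,
        koszul_theta hT (cochains_le_allCochains _ _ hb)⟩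
    · rintro ⟨y, hy, hyx⟩
      rw [SetLike.mem_coe, ← hi1] at hy
      obtain ⟨b, hb, rfl⟩ := hy
      refine ⟨b, hb, ?_⟩
      have hδb := map_delta_cochains_le (m := m) hT α _ ⟨b, hb, rfl⟩
      rw [koszul_theta hT (cochains_le_allCochains _ _ hb)] at hyx
      refine sub_eq_zero.1 (theta_injective hT (Submodule.sub_mem _
        (cochains_le_allCochains _ _ hδb) (cochains_le_allCochains _ _ hc)) ?_)
      rw [map_sub, hyx, sub_self]

end MonMatrix

/-! ### Koszul complexes of graded free modules -/

section FreeKoszul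

variable {k : Type*} [Field k] {n : ℕ} {ι : Type*}

/-- The contracting homotopy of the simplicial complex underlying the Koszul complex in one
multidegree: a cycle `c` is the boundary of `L ↦ sgn[p, L] c(L \ p)`, supported on the `L ∋ p`. -/
theorem sum_homotopy_eq (c : Finset (Fin n) → k) (p : Fin n)
    (hc : ∀ L, ∑ t ∈ Finset.univ.filter fun t => t ∉ L,
      sgnElt k t (insert t L) * c (insert t L) = 0) (L : Finset (Fin n)) :
    ∑ t ∈ Finset.univ.filter fun t => t ∉ L, sgnElt k t (insert t L) *
      (if p ∈ insert t L then sgnElt k p (insert t L) * c ((insert t L).erase p) else 0) = c L := by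
  by_cases hp : p ∈ L
  · set L' := L.erase p with hL'
    have hpL' : p ∉ L' := Finset.notMem_erase p L
    have hL : L = insert p L' := (Finset.insert_erase hp).symm
    have h1 := hc L'
    have hset : (Finset.univ.filter fun t => t ∉ L') =
        insert p (Finset.univ.filter fun t => t ∉ L) := by
      ext t
      simp only [hL, Finset.mem_filter, Finset.mem_univ, true_and, Finset.mem_insert]
      grind
    rw [hset, Finset.sum_insert (by simp [hp]), ← hL] at h1
    have h2 : ∀ t ∈ Finset.univ.filter fun t => t ∉ L, sgnElt k t (insert t L) *
        (if p ∈ insert t L then sgnElt k p (insert t L) * c ((insert t L).erase p) else 0) =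
        -sgnElt k p L * (sgnElt k t (insert t L') * c (insert t L')) := by
      intro t ht
      simp only [Finset.mem_filter, Finset.mem_univ, true_and] at ht
      have htp : t ≠ p := by rintro rfl; exact ht hp
      have htL' : t ∉ L' := fun h => ht (Finset.mem_of_mem_erase h)
      rw [if_pos (Finset.mem_insert_of_mem hp), Finset.erase_insert_of_ne htp, ← hL']
      have h3 := sgnElt_mul_sgnElt_insert (k := k) htp htL' hpL'
      rw [Finset.insert_comm p t, ← hL] at h3
      have h4 := sgnElt_mul_self (k := k) t (insert t L')
      have h5 := sgnElt_mul_self (k := k) t (insert t L)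
      linear_combination c (insert t L') * sgnElt k t (insert t L) * sgnElt k t (insert t L') * h3
        - c (insert t L') * sgnElt k t (insert t L) * sgnElt k p (insert t L) * h4
        - c (insert t L') * sgnElt k p L * sgnElt k t (insert t L') * h5
    rw [Finset.sum_congr rfl h2, ← Finset.mul_sum]
    linear_combination -sgnElt k p L * h1 + c L * sgnElt_mul_self (k := k) p L
  · rw [Finset.sum_eq_single p]
    · rw [if_pos (Finset.mem_insert_self _ _), Finset.erase_insert hp, ← mul_assoc,
        sgnElt_mul_self, one_mul]
    · intro t _ htp
      rw [if_neg, mul_zero]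
      simp only [Finset.mem_insert, not_or]
      exact ⟨htp.symm, hp⟩
    · intro h; simp [hp] at h

/-- In the Koszul complex of a free module of rank one, restricted to one multidegree, the
differential acts on coefficients as a simplicial boundary. -/
theorem koszulMap_smul_mMon (b : MDeg n) (c : Finset (Fin n) → k)
    (hc : ∀ L, c L ≠ 0 → 0 ≤ b - mInd L) (L : Finset (Fin n)) :
    koszulMap k (fun L => c L • mMon k (b - mInd L)) L =
      (∑ t ∈ Finset.univ.filter fun t => t ∉ L, sgnElt k t (insert t L) * c (insert t L)) •
        mMon k (b - mInd L) := by
  rw [koszulMap_apply, Finset.sum_smul]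
  refine Finset.sum_congr rfl fun t ht => ?_
  simp only [Finset.mem_filter, Finset.mem_univ, true_and] at ht
  by_cases h : c (insert t L) = 0
  · simp [h]
  · have h1 := sub_mInd_erase (α := b) (Finset.mem_insert_self t L)
    rw [Finset.erase_insert ht] at h1
    rw [h1, ← mMon_mul (mInd_nonneg _) (hc _ h), mMon_mInd, Finset.prod_singleton, mul_smul,
      smul_eq_mul, smul_eq_mul, C_mul', mul_smul_comm, smul_smul]

theorem nonneg_of_insert {b : MDeg n} {L : Finset (Fin n)} {t : Fin n}
    (h : 0 ≤ b - mInd (insert t L)) : 0 ≤ b - mInd L := by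
  intro p
  have := h p
  simp only [mInd, Pi.sub_apply, Pi.zero_apply, Finset.mem_insert] at this ⊢
  split_ifs at this ⊢ <;> first | omega | (exfalso; tauto)

/-- Exactness of the augmented Koszul complex of a free module of rank one in multidegree `b`,
in homological degree `q`. -/
theorem exists_koszulMap_eq_of_rank_one {b : MDeg n} {q : ℕ}
    {f : Finset (Fin n) → MvPolynomial (Fin n) k}
    (hf : ∀ L, (L.card = q ∧ ∃ c : k, f L = c • mMon k (b - mInd L)) ∨ f L = 0)
    (hδ : koszulMap k f = 0) (h0 : q = 0 → coeff 0 (f ∅) = 0) :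
    ∃ h : Finset (Fin n) → MvPolynomial (Fin n) k,
      (∀ L, (L.card = q + 1 ∧ ∃ c : k, h L = c • mMon k (b - mInd L)) ∨ h L = 0) ∧
      koszulMap k h = f := by
  classical
  have hex : ∀ L, ∃ c : k, f L = c • mMon k (b - mInd L) ∧
      (c ≠ 0 → L.card = q ∧ 0 ≤ b - mInd L) := by
    intro L
    rcases hf L with ⟨hL, c, hc⟩ | hL
    · by_cases hb : 0 ≤ b - mInd L
      · exact ⟨c, hc, fun _ => ⟨hL, hb⟩⟩
      · exact ⟨0, by rw [hc, mMon_of_not_nonneg hb]; simp, by simp⟩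
    · exact ⟨0, by simp [hL], by simp⟩
  choose c hc hc' using hex
  have hfc : f = fun L => c L • mMon k (b - mInd L) := funext hc
  have hcycle : ∀ L, ∑ t ∈ Finset.univ.filter fun t => t ∉ L,
      sgnElt k t (insert t L) * c (insert t L) = 0 := by
    intro L
    by_cases hb : 0 ≤ b - mInd L
    · have h1 := congrFun hδ L
      rw [hfc, koszulMap_smul_mMon b c (fun L h => (hc' L h).2), Pi.zero_apply,
        smul_eq_zero] at h1
      exact h1.resolve_right (mMon_ne_zero hb)
    · refine Finset.sum_eq_zero fun t _ => ?_
      by_contra h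
      exact hb (nonneg_of_insert (hc' _ (right_ne_zero_of_mul h)).2)
  by_cases hS : ∃ p, b p ≠ 0
  -- in multidegree `b ≠ 0`, contract along a variable `x_p` with `b_p ≠ 0`
  · obtain ⟨p, hp⟩ := hS
    set e : Finset (Fin n) → k := fun L => if p ∈ L then sgnElt k p L * c (L.erase p) else 0
      with he
    have he' : ∀ L, e L ≠ 0 → L.card = q + 1 ∧ 0 ≤ b - mInd L := by
      intro L hL
      simp only [he] at hL
      split_ifs at hL with hpL
      · obtain ⟨h1, h2⟩ := hc' _ (right_ne_zero_of_mul hL)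
        refine ⟨by rw [← h1, Finset.card_erase_add_one hpL], fun r => ?_⟩
        have h3 := h2 r
        simp only [mInd, Pi.sub_apply, Pi.zero_apply, Finset.mem_erase] at h3 ⊢
        by_cases hr : r = p
        · subst hr; simp [hpL] at h3 ⊢; omega
        · simpa [hr] using h3
      · exact absurd rfl hL
    refine ⟨fun L => e L • mMon k (b - mInd L), fun L => ?_, ?_⟩
    · by_cases hL : e L = 0
      · right; simp [hL]
      · exact Or.inl ⟨(he' L hL).1, _, rfl⟩
    · funext L
      rw [koszulMap_smul_mMon b e (fun L h => (he' L h).2), hc L]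
      congr 1
      exact sum_homotopy_eq c p hcycle L
  -- in multidegree `b = 0` only `L = ∅` occurs, and the augmentation excludes it
  · push Not at hS
    refine ⟨0, fun L => Or.inr rfl, ?_⟩
    rw [map_zero]
    funext L
    rw [Pi.zero_apply, hc]
    by_cases hcL : c L = 0
    · simp [hcL]
    · exfalso
      obtain ⟨h1, h2⟩ := hc' L hcL
      have hL : L = ∅ := by
        refine Finset.eq_empty_of_forall_notMem fun p hp => ?_
        have := h2 p
        simp [mInd, hp, hS p] at this
      subst hL
      have h3 := h0 (by simpa using h1.symm)
      rw [hc, mMon_of_nonneg h2, coeff_smul, coeff_monomial, if_pos, smul_eq_mul, mul_one] at h3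
      · exact hcL h3
      · ext p; simp [toExp, hS p, mInd]

/-- `(F ⊗ K_q)_α` for the graded free module `F` with generators in the degrees `deg g`. -/
def koszulFreePart (k : Type*) [Field k] {n : ℕ} {ι : Type*} (deg : ι → MDeg n) (α : MDeg n)
    (q : ℕ) : Submodule k (Finset (Fin n) → ι → MvPolynomial (Fin n) k) :=
  Submodule.pi Set.univ fun L => if L.card = q then freePart k deg (α - mInd L) else ⊥

theorem mem_koszulFreePart {deg : ι → MDeg n} {α : MDeg n} {q : ℕ}
    {f : Finset (Fin n) → ι → MvPolynomial (Fin n) k} :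
    f ∈ koszulFreePart k deg α q ↔
      ∀ L, f L ∈ if L.card = q then freePart k deg (α - mInd L) else ⊥ := by
  simp [koszulFreePart, Submodule.mem_pi]

theorem koszulMap_mem_koszulFreePart {deg : ι → MDeg n} {α : MDeg n} {q : ℕ}
    {f : Finset (Fin n) → ι → MvPolynomial (Fin n) k} (hf : f ∈ koszulFreePart k deg α (q + 1)) :
    koszulMap k f ∈ koszulFreePart k deg α q := by
  rw [mem_koszulFreePart] at hf ⊢
  intro L
  rw [koszulMap_apply]
  refine Submodule.sum_mem _ fun t ht => ?_
  simp only [Finset.mem_filter, Finset.mem_univ, true_and] at ht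
  have h := hf (insert t L)
  rw [Finset.card_insert_of_notMem ht] at h
  by_cases hL : L.card = q
  · rw [if_pos (by omega)] at h
    rw [if_pos hL, C_mul', smul_assoc]
    refine Submodule.smul_mem _ _ ?_
    have h1 := mMon_smul_mem_freePart (b := mInd {t}) h
    rwa [← sub_mInd_erase (Finset.mem_insert_self t L), Finset.erase_insert ht, mMon_mInd,
      Finset.prod_singleton] at h1
  · rw [if_neg (by omega)] at h
    rw [(Submodule.mem_bot k).1 h, smul_zero]
    exact Submodule.zero_mem _

theorem koszulMap_eq_zero_of_mem {deg : ι → MDeg n} {α : MDeg n}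
    {f : Finset (Fin n) → ι → MvPolynomial (Fin n) k} (hf : f ∈ koszulFreePart k deg α 0) :
    koszulMap k f = 0 := by
  rw [mem_koszulFreePart] at hf
  funext L
  rw [koszulMap_apply]
  refine Finset.sum_eq_zero fun t _ => ?_
  have h := hf (insert t L)
  rw [if_neg (Finset.card_ne_zero_of_mem (Finset.mem_insert_self t L))] at h
  rw [(Submodule.mem_bot k).1 h, smul_zero]

/-- Exactness of the augmented Koszul complex of a graded free module. -/
theorem exists_koszulMap_eq {deg : ι → MDeg n} {α : MDeg n} {q : ℕ}
    {f : Finset (Fin n) → ι → MvPolynomial (Fin n) k} (hf : f ∈ koszulFreePart k deg α q)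
    (hδ : koszulMap k f = 0) (h0 : q = 0 → ∀ g, coeff 0 (f ∅ g) = 0) :
    ∃ h ∈ koszulFreePart k deg α (q + 1), koszulMap k h = f := by
  rw [mem_koszulFreePart] at hf
  have hex : ∀ g, ∃ h : Finset (Fin n) → MvPolynomial (Fin n) k,
      (∀ L, (L.card = q + 1 ∧ ∃ c : k, h L = c • mMon k (α - deg g - mInd L)) ∨ h L = 0) ∧
      koszulMap k h = fun L => f L g := by
    intro g
    refine exists_koszulMap_eq_of_rank_one (q := q) (fun L => ?_) ?_ fun hq => h0 hq g
    · have h := hf L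
      split_ifs at h with hL
      · left
        rw [sub_right_comm]
        exact ⟨hL, mem_freePart_iff.1 h g⟩
      · right
        rw [(Submodule.mem_bot k).1 h, Pi.zero_apply]
    · exact (koszulMap_comp (LinearMap.proj g :
        (ι → MvPolynomial (Fin n) k) →ₗ[MvPolynomial (Fin n) k] _) f).trans (by rw [hδ]; rfl)
  choose h hh hh' using hex
  refine ⟨fun L g => h g L, mem_koszulFreePart.2 fun L => ?_, ?_⟩
  · split_ifs with hL
    · refine mem_freePart_iff.2 fun g => ?_
      rcases hh g L with ⟨-, h⟩ | h
      · rwa [sub_right_comm] at h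
      · exact ⟨0, by rw [h, zero_smul]⟩
    · refine (Submodule.mem_bot k).2 (funext fun g => ?_)
      exact (hh g L).resolve_left fun h => hL h.1
  · funext L g
    have h1 := koszulMap_comp (LinearMap.proj g :
        (ι → MvPolynomial (Fin n) k) →ₗ[MvPolynomial (Fin n) k] _) (fun L g => h g L)
    exact (congrFun h1 L).symm.trans (congrFun (hh' g) L)

end FreeKoszul

/-! ### Independence of the resolution -/

namespace MonMatrix

variable {k : Type*} [Field k] {n s l : ℕ} {A : MonMatrix k n s l} {γ : Fin l → MDeg n}
  {β : Fin s → MDeg n}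

namespace FreeResolution

variable (F : A.FreeResolution β)

theorem d_mem_freePart (i : ℕ) {α : MDeg n} {f : Fin (F.rank (i + 1)) → MvPolynomial (Fin n) k}
    (hf : f ∈ freePart k (F.deg (i + 1)) α) : F.d i f ∈ freePart k (F.deg i) α :=
  map_mem_freePart _ (F.d_homogeneous i) α hf

theorem d_hcomp (i : ℕ) (α : MDeg n) (f : Fin (F.rank (i + 1)) → MvPolynomial (Fin n) k) :
    F.d i (hcomp (F.deg (i + 1)) α f) = hcomp (F.deg i) α (F.d i f) :=
  map_hcomp ((F.d i).restrictScalars k) (fun _ _ h => F.d_mem_freePart i h) α f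

theorem d_d (i : ℕ) (f : Fin (F.rank (i + 2)) → MvPolynomial (Fin n) k) :
    F.d i (F.d (i + 1) f) = 0 := by
  have : F.d (i + 1) f ∈ LinearMap.ker (F.d i) := F.exact_succ i ▸ ⟨f, rfl⟩
  exact this

theorem aug_d (f : Fin (F.rank 1) → MvPolynomial (Fin n) k) : F.aug (F.d 0 f) = 0 := by
  have : F.d 0 f ∈ LinearMap.ker F.aug := F.exact_zero ▸ ⟨f, rfl⟩
  exact this

/-- The resolution is exact in each degree. -/
theorem exists_d_eq (i : ℕ) {α : MDeg n} {f : Fin (F.rank (i + 1)) → MvPolynomial (Fin n) k}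
    (hf : f ∈ freePart k (F.deg (i + 1)) α) (h : F.d i f = 0) :
    ∃ y ∈ freePart k (F.deg (i + 2)) α, F.d (i + 1) y = f := by
  obtain ⟨y, hy⟩ : f ∈ LinearMap.range (F.d (i + 1)) := by rw [F.exact_succ]; exact h
  exact ⟨_, hcomp_mem _ α y, by rw [d_hcomp, hy, hcomp_of_mem hf]⟩

theorem exists_d_zero_eq {α : MDeg n} {f : Fin (F.rank 0) → MvPolynomial (Fin n) k}
    (hf : f ∈ freePart k (F.deg 0) α) (h : F.aug f = 0) :
    ∃ y ∈ freePart k (F.deg 1) α, F.d 0 y = f := by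
  obtain ⟨y, hy⟩ : f ∈ LinearMap.range (F.d 0) := by rw [F.exact_zero]; exact h
  exact ⟨_, hcomp_mem _ α y, by rw [d_hcomp, hy, hcomp_of_mem hf]⟩

/-- The augmentation lifts to a homogeneous map into the free module covering `M_A`. -/
theorem exists_aug_lift : ∃ T : (Fin (F.rank 0) → MvPolynomial (Fin n) k)
      →ₗ[MvPolynomial (Fin n) k] (Fin s → MvPolynomial (Fin n) k),
    (∀ α, ∀ f ∈ freePart k (F.deg 0) α, T f ∈ freePart k β α) ∧
      ∀ f, A.im.mkQ (T f) = F.aug f := by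
  choose u hu hu' using F.aug_homogeneous
  refine ⟨Fintype.linearCombination _ u, fun α f hf => map_mem_freePart _ (fun g => ?_) α hf,
    fun f => ?_⟩
  · rw [Fintype.linearCombination_apply_single, one_smul]
    exact hu g
  · have : A.im.mkQ ∘ₗ Fintype.linearCombination _ u = F.aug := by
      refine (Pi.basisFun (MvPolynomial (Fin n) k) (Fin (F.rank 0))).ext fun g => ?_
      rw [Pi.basisFun_apply, LinearMap.comp_apply, Fintype.linearCombination_apply_single,
        one_smul]
      exact hu' g
    exact LinearMap.congr_fun this f

theorem aug_mem_part {α : MDeg n} {f : Fin (F.rank 0) → MvPolynomial (Fin n) k}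
    (hf : f ∈ freePart k (F.deg 0) α) : F.aug f ∈ A.part β α := by
  obtain ⟨T, hT, hT'⟩ := F.exists_aug_lift
  exact ⟨T f, hT α f hf, hT' f⟩

/-- The augmentation is surjective in each degree. -/
theorem exists_aug_eq (hT : A.IsSquarefreeSolution γ β) {α : MDeg n} {x : A.Coker}
    (hx : x ∈ A.part β α) : ∃ f ∈ freePart k (F.deg 0) α, F.aug f = x := by
  obtain ⟨T, hT1, hT2⟩ := F.exists_aug_lift
  obtain ⟨u, hu, rfl⟩ := hx
  obtain ⟨y, hy⟩ := F.aug_surjective (A.im.mkQ u)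
  refine ⟨_, hcomp_mem _ α y, ?_⟩
  rw [← hT2] at hy ⊢
  have h1 : T y - u ∈ A.im := (Submodule.Quotient.eq _).1 hy
  have h2 := hcomp_mem_im hT α h1
  rw [map_sub, hcomp_of_mem hu, show hcomp β α (T y) = T (hcomp _ α y) from
    (map_hcomp (T.restrictScalars k) hT1 α y).symm] at h2
  exact (Submodule.Quotient.eq _).2 h2

/-- The map `F_p ⊗ K_0 → F_p ⊗ k`. -/
def fibreMap (p : ℕ) : (Finset (Fin n) → Fin (F.rank p) → MvPolynomial (Fin n) k) →ₗ[k]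
    (Fin (F.rank p) → k) :=
  LinearMap.pi fun g => lcoeff k 0 ∘ₗ LinearMap.proj g ∘ₗ LinearMap.proj ∅

theorem fibreMap_apply (p : ℕ) (z : Finset (Fin n) → Fin (F.rank p) → MvPolynomial (Fin n) k)
    (g : Fin (F.rank p)) : F.fibreMap p z g = constantCoeff (z ∅ g) := rfl

/-- Reduction modulo `(x_1, …, x_n)` commutes with the differentials. -/
theorem constantCoeff_d (i : ℕ) (f : Fin (F.rank (i + 1)) → MvPolynomial (Fin n) k) :
    F.dBar i (fun h => constantCoeff (f h)) = fun g => constantCoeff (F.d i f g) := by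
  funext g
  conv_rhs => rw [pi_eq_sum_univ' f]
  rw [map_sum, Finset.sum_apply, map_sum, dBar, Matrix.mulVecLin_apply, Matrix.mulVec, dotProduct]
  refine Finset.sum_congr rfl fun h _ => ?_
  rw [map_smul, Pi.smul_apply, smul_eq_mul, map_mul, mul_comm]
  rfl

/-- The double complex `(F_• ⊗ K_•)_α`, augmented to `(M_A ⊗ K_•)_α` and to `(F_• ⊗ k)_α`. -/
def doubleComplex (hT : A.IsSquarefreeSolution γ β) (α : MDeg n) :
    AugmentedDoubleComplex k
      (fun p => Finset (Fin n) → Fin (F.rank p) → MvPolynomial (Fin n) k)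
      (fun p => Fin (F.rank p) → k) (Finset (Fin n) → A.Coker) where
  D p q := koszulFreePart k (F.deg p) α q
  d p := ((F.d p).restrictScalars k).compLeft _
  δ p := koszulMap k
  X q := A.koszulPart β α q
  δX := A.koszul
  ε := (F.aug.restrictScalars k).compLeft _
  Y p := F.fibre p α
  dY p := F.dBar p
  η p := F.fibreMap p
  d_mem := by
    intro p q z hz
    rw [mem_koszulFreePart] at hz ⊢
    intro L
    have h := hz L
    split_ifs at h ⊢
    · exact F.d_mem_freePart p h
    · rw [Submodule.mem_bot] at h ⊢
      exact (congrArg (F.d p) h).trans (map_zero _)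
  δ_mem := koszulMap_mem_koszulFreePart
  δ_zero := koszulMap_eq_zero_of_mem
  ε_mem := by
    intro q z hz
    rw [mem_koszulFreePart] at hz
    rw [koszulPart, Submodule.mem_pi]
    intro L _
    have h := hz L
    split_ifs at h ⊢
    · exact F.aug_mem_part h
    · rw [Submodule.mem_bot] at h ⊢
      exact (congrArg F.aug h).trans (map_zero _)
  η_mem := by
    intro p z hz g hg
    have h := (mem_koszulFreePart.1 hz) ∅
    rw [if_pos Finset.card_empty] at h
    have h1 := h g 0 (mem_support_iff.2 hg)
    funext r
    simpa [mInd] using congrFun h1 r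
  δ_d p z := koszulMap_comp (F.d p) z
  ε_δ z := (koszulMap_comp F.aug z).symm
  η_d p z := (F.constantCoeff_d p (z ∅)).symm
  η_δ p z := by
    funext g
    rw [fibreMap_apply, koszulMap_apply, Finset.sum_apply, map_sum]
    refine Finset.sum_eq_zero fun t _ => ?_
    simp
  ε_d z := funext fun L => F.aug_d (z L)
  d_d p z := funext fun L => F.d_d p (z L)
  δ_δ p z := koszulMap_koszulMap z
  ε_surj := by
    intro q x hx
    rw [koszulPart, Submodule.mem_pi] at hx
    have hex : ∀ L, ∃ f ∈ (if L.card = q then freePart k (F.deg 0) (α - mInd L) else ⊥),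
        F.aug f = x L := by
      intro L
      have h := hx L (Set.mem_univ _)
      split_ifs at h ⊢
      · exact F.exists_aug_eq hT h
      · exact ⟨0, Submodule.zero_mem _, by rw [map_zero, (Submodule.mem_bot k).1 h]⟩
    choose f hf hf' using hex
    exact ⟨f, mem_koszulFreePart.2 hf, funext hf'⟩
  η_surj := by
    intro p y hy
    refine ⟨Pi.single ∅ fun g => C (y g), mem_koszulFreePart.2 fun L => ?_, ?_⟩
    · by_cases hL : L = ∅
      · subst hL
        rw [if_pos Finset.card_empty, Pi.single_eq_same]
        intro g a ha
        rw [mem_support_iff, coeff_C] at ha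
        have h0 : 0 = a := by by_contra h; simp [h] at ha
        subst h0
        rw [if_pos rfl] at ha
        rw [← hy g ha]
        funext r
        simp [mInd]
      · rw [Pi.single_eq_of_ne hL]; exact Submodule.zero_mem _
    · funext g
      rw [fibreMap_apply, Pi.single_eq_same, constantCoeff_C]
  row_zero := by
    intro q z hz h
    rw [mem_koszulFreePart] at hz
    have hex : ∀ L, ∃ f ∈ (if L.card = q then freePart k (F.deg 1) (α - mInd L) else ⊥),
        F.d 0 f = z L := by
      intro L
      have h' := hz L
      split_ifs at h' ⊢
      · exact F.exists_d_zero_eq h' (congrFun h L)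
      · exact ⟨0, Submodule.zero_mem _, by rw [map_zero, (Submodule.mem_bot k).1 h']⟩
    choose f hf hf' using hex
    exact ⟨f, mem_koszulFreePart.2 hf, funext hf'⟩
  row_succ := by
    intro p q z hz h
    rw [mem_koszulFreePart] at hz
    have hex : ∀ L, ∃ f ∈ (if L.card = q then freePart k (F.deg (p + 2)) (α - mInd L) else ⊥),
        F.d (p + 1) f = z L := by
      intro L
      have h' := hz L
      split_ifs at h' ⊢
      · exact F.exists_d_eq p h' (congrFun h L)
      · exact ⟨0, Submodule.zero_mem _, by rw [map_zero, (Submodule.mem_bot k).1 h']⟩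
    choose f hf hf' using hex
    exact ⟨f, mem_koszulFreePart.2 hf, funext hf'⟩
  col_zero hz h := exists_koszulMap_eq hz (koszulMap_eq_zero_of_mem hz) fun _ => congrFun h
  col_succ hz h := exists_koszulMap_eq hz h fun h' => absurd h' (Nat.succ_ne_zero _)

/-- `Tor(M_A, k)` computed from a free resolution of `M_A` and from the Koszul resolution of `k`. -/
theorem torDim_eq_koszulDim (hT : A.IsSquarefreeSolution γ β) (i : ℕ) (α : MDeg n) :
    F.torDim i α = A.koszulDim β α i := by
  have h := (F.doubleComplex hT α).homologyDim_edges i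
  cases i <;> exact h.symm

/-- For a minimal resolution the differentials of `F_• ⊗ k` vanish. -/
theorem genCount_eq_torDim (hF : F.IsMinimal) (i : ℕ) (α : MDeg n) :
    F.genCount i α = F.torDim i α := by
  classical
  have hd : ∀ i, F.dBar i = 0 := by
    intro i
    refine LinearMap.ext fun c => funext fun g => ?_
    have h := congrFun (F.constantCoeff_d i fun h => C (c h)) g
    simp only [constantCoeff_C] at h
    rw [h, hF]; rfl
  have hZ : F.cycles α i = F.fibre i α := by
    cases i with
    | zero => rfl
    | succ i => simp [cycles, hd]
  rw [torDim, hZ, hd, Submodule.map_zero, homologyDim]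
  have hbot : (⊥ : Submodule k (Fin (F.rank i) → k)).submoduleOf (F.fibre i α) = ⊥ := by
    rw [Submodule.submoduleOf, ← LinearMap.ker, Submodule.ker_subtype]
  rw [(Submodule.quotEquivOfEqBot _ hbot).finrank_eq, genCount]
  let e : F.fibre i α ≃ₗ[k] ({g : Fin (F.rank i) // F.deg i g = α} → k) :=
    { toFun := fun c g => c.1 g
      map_add' := fun _ _ => rfl
      map_smul' := fun _ _ => rfl
      invFun := fun c => ⟨fun g => if h : F.deg i g = α then c ⟨g, h⟩ else 0, fun g hg => by
        by_contra h; simp [h] at hg⟩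
      left_inv := fun c => Subtype.ext (funext fun g => by
        by_cases h : F.deg i g = α
        · simp [h]
        · have : c.1 g = 0 := by by_contra h'; exact h (c.2 g h')
          simp [h, this])
      right_inv := fun c => funext fun g => by simp [g.2] }
  rw [e.finrank_eq, Module.finrank_fintype_fun_eq_card]

end FreeResolution

end MonMatrix
end

theorem mainTheorem5 {k : Type*} [Field k] [CharZero k] {n s l : ℕ} [NeZero s]
    (A : MonMatrix k n s l) (hA : A.IsMultigraded)
    (γ : Fin l → MDeg n) (β : Fin s → MDeg n) (hT : A.IsSquarefreeSolution γ β)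
    (m : MonomialOrder (Fin n)) (α : MDeg n) :
    -- the coefficients `r_{i,j,a}` exist and are unique
    (∀ (i : Fin s) (a : MDeg n), 0 ≤ a → mSupp a ∉ A.cplx m i →
      ∃! ρ : Fin s → k, A.IsReduction β m i a ρ) ∧
    -- `C^•(A, α)` is a cochain complex
    (∀ t : ℤ, (A.cochains β m α t).map (A.delta β m α) ≤ A.cochains β m α (t + 1)) ∧
    (∀ t : ℤ, ∀ c ∈ A.cochains β m α t, A.delta β m α (A.delta β m α c) = 0) ∧
    -- its cohomology computes the graded Betti numbers
    (∀ i : ℕ,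
      A.koszulDim β α i = A.cohomologyDim β m α ((mSupp (α - β 0)).card - i - 1) ∧
      (∀ F : A.FreeResolution β,
        F.torDim i α = A.cohomologyDim β m α ((mSupp (α - β 0)).card - i - 1)) ∧
      (∀ F : A.FreeResolution β, F.IsMinimal →
        F.genCount i α = A.cohomologyDim β m α ((mSupp (α - β 0)).card - i - 1))) := by
  refine ⟨MonMatrix.existsUnique_isReduction hT m, MonMatrix.map_delta_cochains_le hT α,
    fun t c hc => MonMatrix.delta_delta hT α t hc, fun i => ?_⟩
  have h := MonMatrix.koszulDim_eq_cohomologyDim hT m α i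
  refine ⟨h, fun F => ?_, fun F hF => ?_⟩
  · rw [F.torDim_eq_koszulDim hT, h]
  · rw [F.genCount_eq_torDim hF, F.torDim_eq_koszulDim hT, h]
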